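/- Let $G$ be a layered graph with levels $S_0,S_1,\dots,S_{k+1}$, $|S_i|=N_i$, where $S_0$ is a single source vertex, $S_{k+1}$ is a single sink vertex, and each vertex of $S_i$ is joined by a directed edge to every vertex of $S_{i+1}$. Consider the following diffusion limited aggregation process on $G$. Initially only the sink is occupied. At each step $t=1,2,\dots$ a new particle starts from the source and performs a random walk, independent of the previous ones, moving from each level to a uniformly random vertex of the next level; it halts at, and occupies, the last vertex before its walk first meets an occupied vertex. The process stops at the finish time $t_f$, the first step at the end of which the source is occupied. Let $L_i(t)$ be the number of particles halted in level $i$ at the end of step $t$, and for $0\le j\le k$ let $$\mu_{k-j}(t)=\frac{t^{j+1}}{(j+1)!\,N_kN_{k-1}\cdots N_{k-j+1}} .$$ Consider either of the following two models, as $n\to\infty$: (a) equal layers: $N_i=n/k$ for $1\le i\le k$ (an integer), where $k=k(n)$ satisfies $1\le k\le\sqrt{\log n/\log\log n}$; (b) growing layers: $N_i=d^i$ for $0\le i\le k$, $n=d^k$, where $d\to\infty$ and $k\to\infty$. Let $t=t(n)$ be steps and $j=j(n)$ indices, $0\le j\le k$, such that $\mu_{k-\ell}(t)\to\infty$ for all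 $\ell\le j$ (that is, $\min_{0\le\ell\le j}\mu_{k-\ell}(t)\to\infty$). Then, with high probability, if $t<t_f$ then $L_{k-j}(t)\sim\mu_{k-j}(t)$; that is, for every fixed $\varepsilon>0$, $$\Pr\left(t\ge t_f\ \text{ or }\ \left|\frac{L_{k-j}(t)}{\mu_{k-j}(t)}-1\right|\le\varepsilon\right)\longrightarrow 1 .$$ -/

import Mathlib

open MeasureTheory ProbabilityTheory Filter Topology

namespace LayersDLA

/-- The vertices of levels `0, …, k` of the layered graph whose level `i` is a set of `N i` vertices.
The sink (level `k + 1`) is not listed: it is permanently occupied. -/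
abbrev Vertex (k : ℕ) (N : ℕ → ℕ+) : Type := Σ i : Fin (k + 1), Fin (N i)

/-- A walk `u₀ u₁ ⋯ u_k` from level `0` down to level `k` (its last step, to the sink, is forced).
Consecutive levels are completely joined, so every choice of one vertex per level is a walk. -/
abbrev Walk (k : ℕ) (N : ℕ → ℕ+) : Type := (i : Fin (k + 1)) → Fin (N i)

variable {k : ℕ} {N : ℕ → ℕ+}

/-- With `B` the set of occupied vertices, the vertex that the walk `ρ` visits just after level `i`
is occupied. After level `k` comes the sink, which is always occupied. -/
def NextOccupied (B : Finset (Vertex k N)) (ρ : Walk k N) (i : Fin (k + 1)) : Prop :=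
  ∀ h : (i : ℕ) + 1 < k + 1, (⟨⟨i + 1, h⟩, ρ ⟨i + 1, h⟩⟩ : Vertex k N) ∈ B

/-- A particle that follows `ρ` halts at level `i`: this is the first level from which
the next vertex of the walk is occupied. -/
def HaltsAt (B : Finset (Vertex k N)) (ρ : Walk k N) (i : Fin (k + 1)) : Prop :=
  NextOccupied B ρ i ∧ ∀ i' < i, ¬ NextOccupied B ρ i'

/-- The source is occupied (in the models below, level `0` consists of the source alone). -/
def SourceOccupied (B : Finset (Vertex k N)) : Prop := ∃ v ∈ B, v.1 = 0

open Classical in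
/-- One step of the process: unless the process has stopped, the particle that follows `ρ` occupies
the vertex at which it halts. -/
noncomputable def step (B : Finset (Vertex k N)) (ρ : Walk k N) : Finset (Vertex k N) :=
  if SourceOccupied B then B
  else B ∪ Finset.univ.filter fun v => HaltsAt B ρ v.1 ∧ v.2 = ρ v.1

/-- The set of occupied vertices, other than the sink, at the end of step `t`, when the successive
particles follow the walks `ρ 0, ρ 1, ρ 2, …`. -/
noncomputable def occupied (ρ : ℕ → Walk k N) : ℕ → Finset (Vertex k N)
  | 0 => ∅
  | t + 1 => step (occupied ρ t) (ρ t)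

/-- The occupancy `L_i(t)`: the number of particles halted in level `i` at the end of step `t`. -/
noncomputable def occupancy (ρ : ℕ → Walk k N) (i t : ℕ) : ℕ :=
  ((occupied ρ t).filter fun v => (v.1 : ℕ) = i).card

/-- The finish time `t_f`: the first step at whose end the source is occupied. -/
noncomputable def finishTime (ρ : ℕ → Walk k N) : ℕ∞ :=
  ⨅ t : {t : ℕ // SourceOccupied (occupied ρ t)}, ((t : ℕ) : ℕ∞)

/-- The law of the random walk of one particle: from each level it moves to a uniformly random
vertex of the next level. -/
noncomputable def walkLaw (k : ℕ) (N : ℕ → ℕ+) : Measure (Walk k N) :=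
  Measure.pi fun _ => uniformOn Set.univ

instance (k : ℕ) (N : ℕ → ℕ+) : IsProbabilityMeasure (walkLaw k N) := by
  unfold walkLaw; infer_instance

/-- The law of the sequence of walks of the successive particles: they are independent. -/
noncomputable def law (k : ℕ) (N : ℕ → ℕ+) : Measure (ℕ → Walk k N) :=
  Measure.infinitePi fun _ => walkLaw k N

/-- `μ_{k-j}(t) = t ^ (j + 1) / ((j + 1)! * N_k * N_{k-1} * ⋯ * N_{k-j+1})`. -/
noncomputable def mu (k : ℕ) (N : ℕ → ℕ+) (j t : ℕ) : ℝ :=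
  (t : ℝ) ^ (j + 1) / ((Nat.factorial (j + 1) : ℝ) * ∏ i ∈ Finset.range j, ((N (k - i) : ℕ) : ℝ))

/-- Layer sizes of the equal layers model: a source, then layers of `w` vertices each. -/
def equalLayers (w : ℕ+) : ℕ → ℕ+ := fun i => if i = 0 then 1 else w

/-- Layer sizes of the growing layers model: level `i` has `d ^ i` vertices. -/
def growingLayers (d : ℕ+) : ℕ → ℕ+ := fun i => d ^ i

/-- For a sequence of layered graphs (`k m` layers, of sizes `N m 1, …, N m (k m)`): whenever
`j m ≤ k m` and steps `t m` are such that `μ_{k-ℓ}(t) → ∞` for all `ℓ ≤ j` (uniformly in `ℓ`, as `j`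
may vary with `m`), then with high probability, if `t < t_f`, the ratio of `L_{k-j}(t)` to
`μ_{k-j}(t)` is within `ε` of `1`, for each fixed `ε > 0`. -/
def OccupancyAsymptotics (k : ℕ → ℕ) (N : ℕ → ℕ → ℕ+) : Prop :=
  ∀ j t : ℕ → ℕ, (∀ m, j m ≤ k m) →
    (∀ M : ℝ, ∀ᶠ m in atTop, ∀ ℓ ≤ j m, M ≤ mu (k m) (N m) ℓ (t m)) →
    ∀ ε : ℝ, 0 < ε →
      Tendsto
        (fun m => law (k m) (N m)
          {ρ | (t m : ℕ∞) < finishTime ρ →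
            |(occupancy ρ (k m - j m) (t m) : ℝ) / mu (k m) (N m) (j m) (t m) - 1| ≤ ε})
        atTop (𝓝 1)

end LayersDLA

/-! ### Deterministic part: the mean and pair-moment recursions and their explicit solutions. -/

namespace LayersDLA

/-! Measure depth from the sink, let n_a be the width at depth a (n_0 = 1), and put ν_a(t) = t^a /
(a! n_0 ⋯ n_{a-1}), so that μ_{k-j} = ν_{j+1}. To leading order ν_a is the mean number at depth a if
particles never block one another: a vertex at depth a + 1 is gained with probability (number at
depth a) / n_a per step.

The true process is compared with two relaxed ones. Without blocking (`relaxed` with A = k + 1) at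
least as many vertices are occupied. With blocking only at depths up to H (A = k + 1 - H) the
process agrees with the true one as long as depth H + 1 is empty. In both, hits at distinct levels
are independent given the past, so pair moments satisfy a linear recursion; it is dominated by
`pairBound`, which sums over the depth at which two ancestral chains separate (`momentPop_le`). If ν
falls fast enough up to depth H, the second moment is at most ν² (1 + 16 / ν) (`pairBound_self_le`),
and blocking costs the mean only a relative error of order a 4^H ∑ ν_b / n_b
(`le_mean_of_recursion`). Chebyshev's inequality about ν then gives concentration.

The layers beyond H must be thin: once some particle halts at depth H + 1, the source is occupied
within expected time ∑_{b > H} n_b, much less than t / H. This is a potential argument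
(`law_real_unfinished_le`). So if the process still runs at t, then with high probability depth H +
1 was empty at a slightly earlier t', where ν_a(t') is close to ν_a(t). The lower comparison at t',
monotonicity, and the upper comparison at t give the claim for a ≤ H (`law_real_bad_le`). If
ν_{H+1}(t) is large too, the process has finished with high probability and nothing is left to prove
(`law_real_unfinished_le_of_regime`).

`Regular` isolates what is needed of the layer sizes. For equal layers H = k works; for growing
layers H is the first depth at which ν stops decreasing, or k if there is none. -/

lemma succ_pow_ge_three_terms {t : ℝ} (ht : 0 ≤ t) (p : ℕ) :
    t ^ (p + 2) + (p + 2) * t ^ (p + 1) + (p + 2) * (p + 1) / 2 * t ^ p ≤ (t + 1) ^ (p + 2) := by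
  induction p with
  | zero => norm_num; nlinarith
  | succ p ih =>
    have h := mul_le_mul_of_nonneg_right ih (by linarith : 0 ≤ t + 1)
    have hp : 0 ≤ ((p : ℝ) + 2) * (p + 1) / 2 * t ^ p := by positivity
    rw [pow_succ (t + 1)]
    refine le_trans (le_of_eq_of_le ?_ (sub_le_self _ hp)) h
    push_cast
    ring

/-- A unit increment of t^p / p! is at least its derivative at the left end. Hence these
continuous-time solutions are supersolutions of the discrete recursions. -/
lemma exp_term_succ_ge_two {t : ℝ} (ht : 0 ≤ t) (p : ℕ) :
    t ^ (p + 1) / (p + 1).factorial + t ^ p / p.factorial ≤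
      (t + 1) ^ (p + 1) / (p + 1).factorial := by
  have h : t ^ (p + 1) + (p + 1) * t ^ p ≤ (t + 1) ^ (p + 1) := by
    induction p with
    | zero => simp
    | succ p ih =>
      have h := mul_le_mul_of_nonneg_right ih (by linarith : 0 ≤ t + 1)
      have hp : 0 ≤ ((p : ℝ) + 1) * t ^ p := by positivity
      rw [pow_succ (t + 1)]
      refine le_trans (le_of_eq_of_le ?_ (sub_le_self _ hp)) h
      push_cast
      ring
  have hf : (0 : ℝ) < (p + 1).factorial := by positivity
  rw [le_div_iff₀ hf, Nat.factorial_succ]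
  push_cast
  have hf' : (0 : ℝ) < p.factorial := by positivity
  field_simp
  linarith

/-- The second order term pays for steps in which both chains of a pair grow at once. -/
lemma exp_term_succ_ge_three {t : ℝ} (ht : 0 ≤ t) (p : ℕ) :
    t ^ (p + 2) / (p + 2).factorial + t ^ (p + 1) / (p + 1).factorial
      + t ^ p / p.factorial / 2 ≤ (t + 1) ^ (p + 2) / (p + 2).factorial := by
  have h := succ_pow_ge_three_terms ht p
  have hf : (0 : ℝ) < (p + 2).factorial := by positivity
  rw [le_div_iff₀ hf, Nat.factorial_succ, Nat.factorial_succ]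
  push_cast
  have hf' : (0 : ℝ) < p.factorial := by positivity
  field_simp
  linarith

/-- The product of the sizes of the `a` deepest levels, counting the sink. -/
noncomputable def weight (n : ℕ → ℝ) (a : ℕ) : ℝ := ∏ i ∈ Finset.range a, n i

/-- The expected number of particles at depth `a` at time `t`, up to lower order terms. -/
noncomputable def nu (n : ℕ → ℝ) (a : ℕ) (t : ℝ) : ℝ := t ^ a / (a.factorial * weight n a)

/-- The contribution to the mixed moment at depths `a`, `b` of pairs of chains which
separate at depth `g`. -/
noncomputable def branch (n : ℕ → ℝ) (g a b : ℕ) (t : ℝ) : ℝ :=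
  if g ≤ a ∧ g ≤ b then
    ((a - g + (b - g)).choose (a - g) : ℝ) *
      (t ^ (a - g + (b - g) + g) / (a - g + (b - g) + g).factorial) *
      (weight n g / (weight n a * weight n b))
  else 0

/-- The term g = 0 is the product ν_a ν_b of independent chains (`branch_zero`); the others measure
correlation. -/
noncomputable def pairBound (n : ℕ → ℝ) (H a b : ℕ) (t : ℝ) : ℝ :=
  ∑ g ∈ Finset.range (H + 1), branch n g a b t

section
variable {n : ℕ → ℝ} (hn : ∀ a, 0 < n a)
include hn

lemma weight_pos (a : ℕ) : 0 < weight n a := Finset.prod_pos fun i _ => hn i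

omit hn in
lemma weight_succ (a : ℕ) : weight n (a + 1) = weight n a * n a := Finset.prod_range_succ _ _

lemma nu_nonneg (a : ℕ) {t : ℝ} (ht : 0 ≤ t) : 0 ≤ nu n a t := by
  have := weight_pos hn a
  unfold nu; positivity

lemma nu_pos (a : ℕ) {t : ℝ} (ht : 0 < t) : 0 < nu n a t := by
  have := weight_pos hn a
  unfold nu; positivity

omit hn in
lemma nu_zero (t : ℝ) : nu n 0 t = 1 := by simp [nu, weight]

lemma nu_succ (a : ℕ) (t : ℝ) : nu n (a + 1) t = nu n a t * (t / ((a + 1) * n a)) := by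
  have := weight_pos hn a
  have := hn a
  unfold nu
  rw [weight_succ, Nat.factorial_succ]
  push_cast
  field_simp
  ring

lemma nu_add_one_ge (a : ℕ) {t : ℝ} (ht : 0 ≤ t) :
    nu n (a + 1) t + nu n a t / n a ≤ nu n (a + 1) (t + 1) := by
  have hw := weight_pos hn a
  have hna := hn a
  have h := mul_le_mul_of_nonneg_right (exp_term_succ_ge_two ht a)
    (inv_nonneg.2 (mul_pos hw hna).le)
  unfold nu
  rw [weight_succ]
  refine le_of_eq_of_le ?_ (h.trans_eq ?_)
  · field_simp
  · field_simp

lemma branch_nonneg (g a b : ℕ) {t : ℝ} (ht : 0 ≤ t) : 0 ≤ branch n g a b t := by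
  have := weight_pos hn a
  have := weight_pos hn b
  have := weight_pos hn g
  unfold branch; split_ifs <;> positivity

lemma pairBound_nonneg (H a b : ℕ) {t : ℝ} (ht : 0 ≤ t) : 0 ≤ pairBound n H a b t :=
  Finset.sum_nonneg fun _ _ => branch_nonneg hn _ _ _ ht

/-- Each branch is a supersolution of the pair-moment recursion. Pascal's rule splits the
coefficient according to which chain grows last. The source term on the diagonal, one new vertex
extending both chains, is charged to the branch g = a + 1 = b + 1. -/
lemma branch_succ_succ (g a b : ℕ) {t : ℝ} (ht : 0 ≤ t) :
    branch n g (a + 1) (b + 1) t + branch n g a (b + 1) t / n a + branch n g (a + 1) b t / n b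
      + branch n g a b t / (n a * n b) + (if g = a + 1 ∧ a = b then nu n a t / n a else 0)
      ≤ branch n g (a + 1) (b + 1) (t + 1) := by
  have hwa := weight_pos hn a
  have hwb := weight_pos hn b
  have hwg := weight_pos hn g
  have hna := hn a
  have hnb := hn b
  by_cases h1 : g ≤ a
  · by_cases h2 : g ≤ b
    · obtain ⟨x, rfl⟩ := Nat.exists_eq_add_of_le h1
      obtain ⟨y, rfl⟩ := Nat.exists_eq_add_of_le h2
      have e1 : g + x + 1 - g = x + 1 := by omega
      have e2 : g + y + 1 - g = y + 1 := by omega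
      have e3 : g + x - g = x := by omega
      have e4 : g + y - g = y := by omega
      rw [if_neg (by omega)]
      unfold branch
      rw [if_pos (by omega), if_pos (by omega), if_pos (by omega), if_pos (by omega),
        if_pos (by omega), e1, e2, e3, e4, weight_succ, weight_succ]
      have p1 : x + 1 + (y + 1) + g = (x + y + g) + 2 := by ring
      have p2 : x + (y + 1) + g = (x + y + g) + 1 := by ring
      have p3 : x + 1 + y + g = (x + y + g) + 1 := by ring
      rw [p1, p2, p3]
      have c1 : ((x + 1 + (y + 1)).choose (x + 1) : ℝ)
          = (x + (y + 1)).choose x + (x + 1 + y).choose (x + 1) := by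
        have : x + 1 + (y + 1) = (x + y + 1) + 1 := by ring
        rw [this, Nat.choose_succ_succ', show x + (y + 1) = x + y + 1 by ring,
          show x + 1 + y = x + y + 1 by ring]
        push_cast; ring
      -- The factor 2 cancels the 1/2 in `exp_term_succ_ge_three`.
      have c2 : 2 * ((x + y).choose x : ℝ) ≤ (x + 1 + (y + 1)).choose (x + 1) := by
        have h1 : (x + y).choose x ≤ (x + (y + 1)).choose x :=
          Nat.choose_le_choose _ (by omega)
        have h2 : (x + y).choose x ≤ (x + 1 + y).choose (x + 1) := by
          rw [show x + 1 + y = (x + y) + 1 by ring, Nat.choose_succ_succ']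
          omega
        have h1' : ((x + y).choose x : ℝ) ≤ (x + (y + 1)).choose x := by exact_mod_cast h1
        have h2' : ((x + y).choose x : ℝ) ≤ (x + 1 + y).choose (x + 1) := by exact_mod_cast h2
        rw [c1]; linarith
      have e := exp_term_succ_ge_three ht (x + y + g)
      have hC : (0 : ℝ) ≤ (x + 1 + (y + 1)).choose (x + 1) := by positivity
      have hE := mul_le_mul_of_nonneg_left e hC
      have hT : (0 : ℝ) ≤ t ^ (x + y + g) / (x + y + g).factorial := by positivity
      have hF := mul_le_mul_of_nonneg_right c2 hT
      have hW : 0 ≤ weight n g / (weight n (g + x) * n (g + x) * (weight n (g + y) * n (g + y))) := by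
        positivity
      have key := mul_le_mul_of_nonneg_right
        (show ((x + 1 + (y + 1)).choose (x + 1) : ℝ) *
              (t ^ (x + y + g + 2) / (x + y + g + 2).factorial)
            + ((x + (y + 1)).choose x : ℝ) * (t ^ (x + y + g + 1) / (x + y + g + 1).factorial)
            + ((x + 1 + y).choose (x + 1) : ℝ)
              * (t ^ (x + y + g + 1) / (x + y + g + 1).factorial)
            + ((x + y).choose x : ℝ) * (t ^ (x + y + g) / (x + y + g).factorial)
          ≤ ((x + 1 + (y + 1)).choose (x + 1) : ℝ)
            * ((t + 1) ^ (x + y + g + 2) / (x + y + g + 2).factorial) by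
          rw [mul_add, mul_add] at hE
          have : ((x + 1 + (y + 1)).choose (x + 1) : ℝ) *
              (t ^ (x + y + g + 1) / (x + y + g + 1).factorial) =
              ((x + (y + 1)).choose x : ℝ) * (t ^ (x + y + g + 1) / (x + y + g + 1).factorial)
            + ((x + 1 + y).choose (x + 1) : ℝ)
              * (t ^ (x + y + g + 1) / (x + y + g + 1).factorial) := by rw [c1]; ring
          linarith) hW
      refine le_of_eq_of_le ?_ key
      field_simp
      ring
    · by_cases h3 : g = b + 1
      · subst h3
        obtain ⟨x, rfl⟩ := Nat.exists_eq_add_of_le h1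
        have e1 : b + 1 + x + 1 - (b + 1) = x + 1 := by omega
        have e3 : b + 1 + x - (b + 1) = x := by omega
        rw [if_neg (by omega)]
        unfold branch
        rw [if_pos (by omega), if_pos (by omega), if_neg (by omega), if_neg (by omega),
          if_pos (by omega), e1, e3, Nat.sub_self, weight_succ, weight_succ]
        have e := exp_term_succ_ge_two ht (x + (b + 1))
        have hW : 0 ≤ weight n b * n b / (weight n (b + 1 + x) * n (b + 1 + x) *
            (weight n b * n b)) := by have := weight_pos hn (b + 1 + x); positivity
        have key := mul_le_mul_of_nonneg_right e hW
        simp only [add_zero, Nat.choose_self, Nat.cast_one, one_mul, zero_div]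
        rw [show x + 1 + (b + 1) = x + (b + 1) + 1 by ring]
        refine le_of_eq_of_le ?_ key
        field_simp
      · unfold branch
        rw [if_neg (by omega), if_neg (by omega), if_neg (by omega), if_neg (by omega),
          if_neg (by omega), if_neg (by omega)]
        simp
  · by_cases h3 : g = a + 1
    · subst h3
      by_cases h2 : a + 1 ≤ b
      · obtain ⟨x, rfl⟩ := Nat.exists_eq_add_of_le h2
        have e1 : a + 1 + x + 1 - (a + 1) = x + 1 := by omega
        have e3 : a + 1 + x - (a + 1) = x := by omega
        rw [if_neg (by omega)]
        unfold branch
        rw [if_pos (by omega), if_neg (by omega), if_pos (by omega), if_neg (by omega),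
          if_pos (by omega), e1, e3, Nat.sub_self, weight_succ, weight_succ]
        have e := exp_term_succ_ge_two ht (x + (a + 1))
        have hW : 0 ≤ weight n a * n a / (weight n a * n a *
            (weight n (a + 1 + x) * n (a + 1 + x))) := by
          have := weight_pos hn (a + 1 + x); positivity
        have key := mul_le_mul_of_nonneg_right e hW
        simp only [zero_add, Nat.choose_zero_right, Nat.cast_one, one_mul, zero_div, add_zero]
        rw [show x + 1 + (a + 1) = x + (a + 1) + 1 by ring]
        refine le_of_eq_of_le ?_ key
        field_simp
      · by_cases h4 : a = b
        · subst h4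
          rw [if_pos (by omega)]
          unfold branch
          rw [if_pos (by omega), if_neg (by omega), if_neg (by omega), if_neg (by omega),
            if_pos (by omega), Nat.sub_self]
          have e := exp_term_succ_ge_two ht a
          have hW : 0 ≤ weight n (a + 1) / (weight n (a + 1) * weight n (a + 1)) := by
            have := weight_pos hn (a + 1); positivity
          have key := mul_le_mul_of_nonneg_right e hW
          simp only [zero_add, Nat.choose_zero_right, Nat.cast_one, one_mul, zero_div, add_zero]
          refine le_of_eq_of_le ?_ key
          rw [weight_succ]
          unfold nu
          field_simp
        · unfold branch
          rw [if_neg (by omega), if_neg (by omega), if_neg (by omega), if_neg (by omega),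
            if_neg (by omega), if_neg (by omega)]
          simp
    · unfold branch
      rw [if_neg (by omega), if_neg (by omega), if_neg (by omega), if_neg (by omega),
        if_neg (by omega), if_neg (by omega)]
      simp

lemma pairBound_succ_succ {H a b : ℕ} (ha : a + 1 ≤ H) {t : ℝ} (ht : 0 ≤ t) :
    pairBound n H (a + 1) (b + 1) t + pairBound n H a (b + 1) t / n a
      + pairBound n H (a + 1) b t / n b
      + pairBound n H a b t / (n a * n b) + (if a = b then nu n a t / n a else 0)
      ≤ pairBound n H (a + 1) (b + 1) (t + 1) := by
  have h := Finset.sum_le_sum fun g (_ : g ∈ Finset.range (H + 1)) =>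
    branch_succ_succ hn g a b ht
  refine le_of_eq_of_le ?_ h
  unfold pairBound
  simp only [Finset.sum_add_distrib, Finset.sum_div]
  congr 1
  split_ifs with hab
  · subst hab
    simp only [and_true, Finset.sum_ite_eq', Finset.mem_range]
    -- The diagonal term sits at g = a + 1, which lies in the range because a + 1 ≤ H.
    rw [if_pos (by omega)]
  · simp [hab]

omit hn in
lemma branch_zero (a b : ℕ) (t : ℝ) : branch n 0 a b t = nu n a t * nu n b t := by
  unfold branch nu
  rw [if_pos (by omega), Nat.sub_zero, Nat.sub_zero, add_zero, Nat.cast_add_choose]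
  have : ((a + b).factorial : ℝ) ≠ 0 := by positivity
  rw [pow_add]
  by_cases ha : weight n a = 0
  · simp [ha]
  by_cases hb : weight n b = 0
  · simp [hb]
  simp only [weight, Finset.range_zero, Finset.prod_empty]
  field_simp

omit hn in
lemma pairBound_zero_left (H b : ℕ) (t : ℝ) : pairBound n H 0 b t = nu n b t := by
  unfold pairBound
  rw [Finset.sum_eq_single 0, branch_zero, nu_zero, one_mul]
  · intro g _ hg
    unfold branch
    rw [if_neg (by omega)]
  · simp

omit hn in
lemma pairBound_zero_right (H a : ℕ) (t : ℝ) : pairBound n H a 0 t = nu n a t := by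
  unfold pairBound
  rw [Finset.sum_eq_single 0, branch_zero, nu_zero, mul_one]
  · intro g _ hg
    unfold branch
    rw [if_neg (by omega)]
  · simp

/-- Mixed moments which satisfy the linear recursion are at most `pairBound`. -/
lemma moment_le_pairBound {H : ℕ} {M : ℕ → ℕ → ℕ → ℝ}
    (hinit : ∀ a b, M a b 0 ≤ if a = 0 ∧ b = 0 then 1 else 0)
    (hone : ∀ s, M 0 0 s ≤ 1)
    (hleft : ∀ b s, b + 1 ≤ H → M 0 (b + 1) (s + 1) ≤ M 0 (b + 1) s + M 0 b s / n b)
    (hright : ∀ a s, a + 1 ≤ H → M (a + 1) 0 (s + 1) ≤ M (a + 1) 0 s + M a 0 s / n a)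
    (hne : ∀ a b s, a + 1 ≤ H → b + 1 ≤ H → a ≠ b → M (a + 1) (b + 1) (s + 1) ≤
      M (a + 1) (b + 1) s + M a (b + 1) s / n a + M (a + 1) b s / n b + M a b s / (n a * n b))
    (heq : ∀ a s, a + 1 ≤ H → M (a + 1) (a + 1) (s + 1) ≤
      M (a + 1) (a + 1) s + M a (a + 1) s / n a + M (a + 1) a s / n a + M 0 a s / n a) :
    ∀ s a b : ℕ, a ≤ H → b ≤ H → M a b s ≤ pairBound n H a b s := by
  intro s
  induction s with
  | zero =>
    intro a b _ _
    refine (hinit a b).trans ?_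
    split_ifs with h
    · obtain ⟨rfl, rfl⟩ := h
      rw [pairBound_zero_left, nu_zero]
    · exact pairBound_nonneg hn _ _ _ (by simp)
  | succ s ih =>
    have hdiv : ∀ {x y : ℝ} (a : ℕ), x ≤ y → x / n a ≤ y / n a := fun a h =>
      div_le_div_of_nonneg_right h (hn a).le
    intro a b ha hb
    push_cast
    rcases a with _ | a
    · rw [pairBound_zero_left]
      rcases b with _ | b
      · rw [nu_zero]; exact hone _
      · have h1 := ih 0 (b + 1) ha hb
        have h2 := hdiv b (ih 0 b ha (by omega))
        rw [pairBound_zero_left] at h1 h2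
        have h3 := nu_add_one_ge hn b (Nat.cast_nonneg (α := ℝ) s)
        linarith [hleft b s hb]
    · rcases b with _ | b
      · rw [pairBound_zero_right]
        have h1 := ih (a + 1) 0 ha hb
        have h2 := hdiv a (ih a 0 (by omega) hb)
        rw [pairBound_zero_right] at h1 h2
        have h3 := nu_add_one_ge hn a (Nat.cast_nonneg (α := ℝ) s)
        linarith [hright a s ha]
      · have h0 := pairBound_succ_succ hn (b := b) ha (Nat.cast_nonneg (α := ℝ) s)
        have h1 := ih (a + 1) (b + 1) ha hb
        have h2 := hdiv a (ih a (b + 1) (by omega) hb)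
        have h3 := hdiv b (ih (a + 1) b ha (by omega))
        by_cases hab : a = b
        · subst hab
          have h4 := hdiv a (ih 0 a (by omega) (by omega))
          rw [pairBound_zero_left] at h4
          rw [if_pos rfl] at h0
          have h5 : 0 ≤ pairBound n H a a s / (n a * n a) :=
            div_nonneg (pairBound_nonneg hn _ _ _ (by simp)) (mul_pos (hn a) (hn a)).le
          linarith [heq a s ha]
        · have h4 := div_le_div_of_nonneg_right (ih a b (by omega) (by omega))
            (mul_pos (hn a) (hn b)).le
          rw [if_neg hab] at h0
          linarith [hne a b s ha hb hab]

/-- Means which satisfy the linear recursion up to a relative error `L` are not much smaller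
than its solution. -/
lemma le_mean_of_recursion {m : ℕ → ℕ → ℝ} {t c : ℕ} {L : ℝ} (hL : 0 ≤ L)
    (hinit : ∀ a, 0 ≤ m a 0) (hone : ∀ s, 1 ≤ m 0 s)
    (hstep : ∀ a s, a + 1 ≤ c → s < t →
      m (a + 1) s + (m a s - L * nu n a s) / n a ≤ m (a + 1) (s + 1)) :
    ∀ s a : ℕ, s ≤ t → a ≤ c → s.choose a / weight n a - a * L * nu n a s ≤ m a s := by
  intro s
  induction s with
  | zero =>
    intro a _ _
    rcases a with _ | a
    · simpa [weight, nu] using hone 0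
    · simpa [nu] using hinit (a + 1)
  | succ s ih =>
    intro a hs ha
    rcases a with _ | a
    · simpa [weight] using hone (s + 1)
    · have h1 := ih (a + 1) (by omega) ha
      have h2 := ih a (by omega) (by omega)
      have h3 := hstep a s ha (by omega)
      have h4 := mul_le_mul_of_nonneg_left (nu_add_one_ge hn a (Nat.cast_nonneg (α := ℝ) s))
        (show 0 ≤ ((a : ℝ) + 1) * L by positivity)
      have h5 := div_le_div_of_nonneg_right
        (sub_le_sub_right h2 (L * nu n a s)) (hn a).le
      have hwa := weight_pos hn a
      have hna := hn a
      have h6 : ((s + 1).choose (a + 1) : ℝ) / weight n (a + 1)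
          = s.choose (a + 1) / weight n (a + 1) + s.choose a / weight n a / n a := by
        rw [Nat.choose_succ_succ', weight_succ]
        push_cast
        field_simp
        ring
      have h7 : ((s.choose a : ℝ) / weight n a - a * L * nu n a s - L * nu n a s) / n a
          = s.choose a / weight n a / n a - (a + 1) * L * (nu n a s / n a) := by
        field_simp
        ring
      rw [h6]
      rw [h7] at h5
      push_cast at h1 ⊢
      linarith

omit hn in
lemma factorial_add_mul_factorial_add_le (x y g : ℕ) :
    (g + x).factorial * (g + y).factorial ≤ (x + y + g).factorial * g.factorial := by
  induction x with
  | zero => simp [Nat.add_comm, Nat.mul_comm]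
  | succ x ih =>
    rw [show g + (x + 1) = (g + x) + 1 by ring, show x + 1 + y + g = (x + y + g) + 1 by ring,
      Nat.factorial_succ, Nat.factorial_succ, mul_assoc, mul_assoc]
    exact Nat.mul_le_mul (by omega) ih

/-- Up to the number of interleavings, a pair sharing its chain up to depth g counts as an
independent pair divided by ν_g. The times s and t are kept apart because in the loss estimate only
the first chain is evaluated at the running time. -/
lemma branch_le {g a b : ℕ} (ha : g ≤ a) (hb : g ≤ b) {s t : ℝ} (hs : 0 ≤ s) (ht : 0 < t)
    (hst : s ≤ t) :
    branch n g a b s ≤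
      ((a - g + (b - g)).choose (a - g) : ℝ) * (nu n a s * nu n b t / nu n g t) := by
  obtain ⟨x, rfl⟩ := Nat.exists_eq_add_of_le ha
  obtain ⟨y, rfl⟩ := Nat.exists_eq_add_of_le hb
  unfold branch
  rw [if_pos ⟨ha, hb⟩, mul_assoc]
  refine mul_le_mul_of_nonneg_left ?_ (by positivity)
  simp only [Nat.add_sub_cancel_left]
  have h1 := weight_pos hn g
  have h2 := weight_pos hn (g + x)
  have h3 := weight_pos hn (g + y)
  have hf : ((g + x).factorial * (g + y).factorial : ℝ) ≤ (x + y + g).factorial * g.factorial := by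
    exact_mod_cast factorial_add_mul_factorial_add_le x y g
  have e : nu n (g + x) s * nu n (g + y) t / nu n g t =
      s ^ (g + x) * t ^ y / ((g + x).factorial * (g + y).factorial / g.factorial) *
      (weight n g / (weight n (g + x) * weight n (g + y))) := by
    unfold nu
    rw [pow_add t]
    field_simp
  rw [e]
  refine mul_le_mul_of_nonneg_right ?_ (by positivity)
  have hp : s ^ (x + y + g) ≤ s ^ (g + x) * t ^ y := by
    rw [show x + y + g = (g + x) + y by ring, pow_add]
    gcongr
  refine div_le_div₀ (by positivity) hp (by positivity) ?_
  rw [div_le_iff₀ (by positivity)]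
  exact hf

omit hn in
lemma sum_four_pow_le (H : ℕ) : ∑ g ∈ Finset.range (H + 1), (4 : ℝ) ^ (H - g) ≤ 2 * 4 ^ H := by
  have h : ∀ H : ℕ, ∑ g ∈ Finset.range (H + 1), (4 : ℝ) ^ (H - g) = (4 ^ (H + 1) - 1) / 3 := by
    intro H
    have := Finset.sum_range_reflect (fun g => (4 : ℝ) ^ g) (H + 1)
    simp only [Nat.add_sub_cancel] at this
    rw [this, geom_sum_eq (by norm_num)]
    norm_num
  rw [h, pow_succ]
  have : (1 : ℝ) ≤ 4 ^ H := one_le_pow₀ (by norm_num)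
  linarith

/-- A crude bound, with a factor exponential in H. It serves only to estimate the loss by blocking,
where it meets the small factor ν_b / n_b. -/
lemma pairBound_le {H a b : ℕ} (ha : a ≤ H) (hb : b ≤ H) {s t : ℝ} (hs : 0 ≤ s) (ht : 0 < t)
    (hst : s ≤ t) (hone : ∀ g ≤ a, 1 ≤ nu n g t) :
    pairBound n H a b s ≤ 2 * 4 ^ H * (nu n a s * nu n b t) := by
  have hN : 0 ≤ nu n a s * nu n b t := mul_nonneg (nu_nonneg hn a hs) (nu_nonneg hn b ht.le)
  refine le_trans ?_ (mul_le_mul_of_nonneg_right (sum_four_pow_le H) hN)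
  rw [Finset.sum_mul]
  refine Finset.sum_le_sum fun g _ => ?_
  by_cases hg : g ≤ a ∧ g ≤ b
  · refine (branch_le hn hg.1 hg.2 hs ht hst).trans ?_
    refine mul_le_mul ?_ (div_le_self hN (hone g hg.1)) (div_nonneg hN (nu_nonneg hn g ht.le))
      (by positivity)
    have h1 : (a - g + (b - g)).choose (a - g) ≤ 2 ^ (a - g + (b - g)) := Nat.choose_le_two_pow _ _
    have h2 : 2 ^ (a - g + (b - g)) ≤ 2 ^ (2 * (H - g)) :=
      Nat.pow_le_pow_right (by norm_num) (by omega)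
    rw [pow_mul] at h2
    exact_mod_cast h1.trans h2
  · unfold branch
    rw [if_neg hg]
    positivity

/-- The expected numbers decrease fast up to depth `H`, except perhaps in the last step. -/
structure Decreasing (n : ℕ → ℝ) (H : ℕ) (t : ℝ) : Prop where
  fast : ∀ a, 1 ≤ a → a + 1 < H → 8 * t ≤ (a + 1) * n a
  last : ∀ a, 1 ≤ a → a + 1 = H → t ≤ (a + 1) * n a

omit hn in
lemma Decreasing.mono {H : ℕ} {s t : ℝ} (h : Decreasing n H t) (hst : s ≤ t) :
    Decreasing n H s :=
  ⟨fun a h1 h2 => by linarith [h.fast a h1 h2], fun a h1 h2 => by linarith [h.last a h1 h2]⟩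

lemma Decreasing.nu_succ_le {H a : ℕ} {t : ℝ} (h : Decreasing n H t) (ht : 0 ≤ t) (ha : 1 ≤ a)
    (haH : a + 1 ≤ H) : nu n (a + 1) t ≤ nu n a t := by
  rw [nu_succ hn]
  refine mul_le_of_le_one_right (nu_nonneg hn a ht) ?_
  have := hn a
  rw [div_le_one (by positivity)]
  rcases haH.lt_or_eq with h' | h'
  · linarith [h.fast a ha h']
  · exact h.last a ha h'

lemma Decreasing.eight_mul_nu_succ_le {H a : ℕ} {t : ℝ} (h : Decreasing n H t) (ht : 0 ≤ t)
    (ha : 1 ≤ a) (haH : a + 1 < H) : 8 * nu n (a + 1) t ≤ nu n a t := by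
  rw [nu_succ hn, ← mul_assoc, mul_comm (8 : ℝ), mul_assoc]
  refine mul_le_of_le_one_right (nu_nonneg hn a ht) ?_
  have := hn a
  rw [← mul_div_assoc, div_le_one (by positivity)]
  exact h.fast a ha haH

lemma Decreasing.nu_le {H a b : ℕ} {t : ℝ} (h : Decreasing n H t) (ht : 0 ≤ t) (ha : 1 ≤ a)
    (hab : a ≤ b) (hb : b ≤ H) : nu n b t ≤ nu n a t := by
  induction b, hab using Nat.le_induction with
  | base => exact le_rfl
  | succ b hab ih => exact (h.nu_succ_le hn ht (by omega) hb).trans (ih (by omega))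

lemma Decreasing.eight_pow_mul_nu_le {H a e : ℕ} {t : ℝ} (h : Decreasing n H t) (ht : 0 ≤ t)
    (ha : 1 ≤ a) (haH : a + e ≤ H) : 8 ^ e * nu n (a + e) t ≤ 8 * nu n a t := by
  have key : ∀ e, a + e < H → 8 ^ e * nu n (a + e) t ≤ nu n a t := by
    intro e
    induction e with
    | zero => simp
    | succ e ih =>
      intro he
      have h1 := h.eight_mul_nu_succ_le hn ht (a := a + e) (by omega) (by omega)
      have h2 := mul_le_mul_of_nonneg_left h1 (show (0 : ℝ) ≤ 8 ^ e by positivity)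
      refine le_trans (le_of_eq ?_) (h2.trans (ih (by omega)))
      rw [← add_assoc]; ring
  -- The last step down to depth H need not gain a factor 8; the 8 on the right pays for it.
  rcases haH.lt_or_eq with h' | h'
  · linarith [key e h', nu_nonneg hn a ht]
  · rcases e with _ | e
    · simp; linarith [nu_nonneg hn a ht]
    · have h1 := h.nu_succ_le hn ht (a := a + e) (by omega) (by omega)
      have h2 := key e (by omega)
      have h3 := mul_le_mul_of_nonneg_left h1 (show (0 : ℝ) ≤ 8 ^ e by positivity)
      rw [pow_succ, ← add_assoc]
      linarith

/-- The second moment is at most the square of the mean, up to lower order terms. -/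
lemma pairBound_self_le {H a : ℕ} {t : ℝ} (h : Decreasing n H t) (ht : 0 < t) (haH : a ≤ H) :
    pairBound n H a a t ≤ nu n a t ^ 2 * (1 + 16 / nu n a t) := by
  have hN := nu_pos hn a ht
  unfold pairBound
  rw [Finset.sum_range_succ', branch_zero]
  have hsum : ∑ g ∈ Finset.range H, branch n (g + 1) a a t ≤ nu n a t * 16 := by
    -- With e = a - (g + 1), the interleavings number at most 4^e while ν_a / ν_{g+1} ≤ 8 / 8^e.
    -- This leaves a geometric series of ratio 1/2, of total at most 8 · 2 = 16.
    have hterm : ∀ g ∈ Finset.range H, branch n (g + 1) a a t ≤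
        if g < a then nu n a t * 8 * (1 / 2) ^ (a - 1 - g) else 0 := by
      intro g _
      split_ifs with hg
      · refine (branch_le hn (show g + 1 ≤ a by omega) (by omega) ht.le ht le_rfl).trans ?_
        obtain ⟨e, rfl⟩ := Nat.exists_eq_add_of_le (show g + 1 ≤ a by omega)
        have e1 : g + 1 + e - (g + 1) = e := by omega
        have e2 : g + 1 + e - 1 - g = e := by omega
        rw [e1, e2]
        have hc : ((e + e).choose e : ℝ) ≤ 4 ^ e := by
          have h1 : (e + e).choose e ≤ 2 ^ (e + e) := Nat.choose_le_two_pow _ _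
          rw [← two_mul, pow_mul, two_mul] at h1
          exact_mod_cast h1
        have hg0 := nu_pos hn (g + 1) ht
        have h8 := h.eight_pow_mul_nu_le hn ht.le (a := g + 1) (e := e) (by omega) (by omega)
        have h9 : nu n (g + 1 + e) t / nu n (g + 1) t ≤ 8 / 8 ^ e := by
          rw [div_le_div_iff₀ hg0 (by positivity)]
          linarith
        calc ((e + e).choose e : ℝ) *
              (nu n (g + 1 + e) t * nu n (g + 1 + e) t / nu n (g + 1) t)
            ≤ 4 ^ e * (nu n (g + 1 + e) t * (8 / 8 ^ e)) := by
              rw [mul_div_assoc]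
              gcongr
          _ = nu n (g + 1 + e) t * 8 * (1 / 2) ^ e := by
              have : (8 : ℝ) ^ e = 4 ^ e * 2 ^ e := by rw [← mul_pow]; norm_num
              rw [this, one_div, inv_pow]
              field_simp
      · unfold branch
        rw [if_neg (by omega)]
    refine (Finset.sum_le_sum hterm).trans ?_
    rw [← Finset.sum_filter]
    have : (Finset.range H).filter (fun g => g < a) = Finset.range a := by
      ext g; simp; omega
    rw [this, ← Finset.mul_sum, Finset.sum_range_reflect (fun i => ((1 : ℝ) / 2) ^ i) a,
      geom_sum_eq (by norm_num)]
    have h1 : (0 : ℝ) ≤ (1 / 2) ^ a := by positivity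
    have h3 : ∀ x : ℝ, (x - 1) / (1 / 2 - 1) = 2 * (1 - x) := fun x => by norm_num; ring
    have h2 : (((1 : ℝ) / 2) ^ a - 1) / (1 / 2 - 1) ≤ 2 := by
      rw [h3]
      linarith
    nlinarith
  have : nu n a t ^ 2 * (1 + 16 / nu n a t) = nu n a t * 16 + nu n a t * nu n a t := by
    field_simp
    ring
  rw [this]
  linarith

/-- The discrete recursion produces binomial coefficients in place of s^a / a!; the relative error
is at most a² / s. -/
lemma one_sub_sq_div_mul_nu_le (a : ℕ) {s : ℕ} (hs : 0 < s) :
    (1 - (a : ℝ) ^ 2 / s) * nu n a s ≤ s.choose a / weight n a := by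
  have hwa := weight_pos hn a
  have key : ∀ a : ℕ, (1 - (a : ℝ) ^ 2 / s) * (s : ℝ) ^ a ≤ s.descFactorial a := by
    intro a
    induction a with
    | zero => simp
    | succ a ih =>
      have hs' : (0 : ℝ) < s := by exact_mod_cast hs
      rw [Nat.descFactorial_succ]
      push_cast
      by_cases h : s ≤ a + 1
      · have h' : (s : ℝ) ≤ (a + 1) ^ 2 := by
          have : (s : ℝ) ≤ a + 1 := by exact_mod_cast h
          nlinarith [(Nat.cast_nonneg a : (0 : ℝ) ≤ a)]
        have : (1 - ((a : ℝ) + 1) ^ 2 / s) ≤ 0 := by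
          rw [sub_nonpos, one_le_div hs']; exact h'
        exact (mul_nonpos_of_nonpos_of_nonneg this (by positivity)).trans (by positivity)
      · rw [Nat.cast_sub (by omega)]
        have h0 : (0 : ℝ) ≤ s - a := by
          have : (a : ℝ) ≤ s := by exact_mod_cast (by omega : a ≤ s)
          linarith
        refine le_trans ?_ (mul_le_mul_of_nonneg_left ih h0)
        have e : (1 - ((a : ℝ) + 1) ^ 2 / s) * (s : ℝ) ^ (a + 1)
            = s * (1 - ((a : ℝ) + 1) ^ 2 / s) * (s : ℝ) ^ a := by ring
        rw [← mul_assoc, e]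
        refine mul_le_mul_of_nonneg_right ?_ (by positivity)
        have : ((s : ℝ) - a) * (1 - a ^ 2 / s) - s * (1 - (a + 1) ^ 2 / s)
          = a ^ 3 / s + a + 1 := by field_simp; ring
        have : (0 : ℝ) ≤ a ^ 3 / s + a + 1 := by positivity
        linarith
  unfold nu
  rw [Nat.choose_eq_descFactorial_div_factorial, Nat.cast_div
    (Nat.factorial_dvd_descFactorial s a) (by positivity)]
  rw [div_div, ← mul_div_assoc]
  gcongr
  exact key a

end

/-! ### Independence of the next walk from the past. -/

variable {k : ℕ} {N : ℕ → ℕ+}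

instance (k : ℕ) (N : ℕ → ℕ+) : IsProbabilityMeasure (law k N) := by
  unfold law; infer_instance

section Before
variable {s : ℕ}

/-- A function of finitely many walks factors through a finite space, which settles all
measurability and integrability questions below. -/
lemma exists_eq_comp_restrict {S : Type*} {f : (ℕ → Walk k N) → S}
    (hf : ∀ ρ ρ', (∀ i < s, ρ i = ρ' i) → f ρ = f ρ') :
    ∃ φ : ((i : Finset.range s) → Walk k N) → S, f = φ ∘ fun ρ (i : Finset.range s) => ρ i := by
  classical
  refine ⟨fun y => f fun i => if h : i ∈ Finset.range s then y ⟨i, h⟩ else fun _ => ⟨0, PNat.pos _⟩,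
    funext fun ρ => hf _ _ fun i hi => ?_⟩
  simp [hi]

lemma measurable_of_before {S : Type*} [MeasurableSpace S] {f : (ℕ → Walk k N) → S}
    (hf : ∀ ρ ρ', (∀ i < s, ρ i = ρ' i) → f ρ = f ρ') : Measurable f := by
  obtain ⟨φ, rfl⟩ := exists_eq_comp_restrict hf
  exact (measurable_of_finite φ).comp (by fun_prop)

lemma integrable_of_before {f : (ℕ → Walk k N) → ℝ}
    (hf : ∀ ρ ρ', (∀ i < s, ρ i = ρ' i) → f ρ = f ρ') : Integrable f (law k N) := by
  have hm := measurable_of_before hf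
  obtain ⟨φ, rfl⟩ := exists_eq_comp_restrict hf
  obtain ⟨C, hC⟩ := (Set.finite_range fun y => ‖φ y‖).bddAbove
  exact Integrable.of_bound hm.aestronglyMeasurable C
    (ae_of_all _ fun ρ => hC ⟨_, rfl⟩)

/-- The next walk is independent of the past. -/
lemma integral_before_next {S : Type*} [Finite S] {X : (ℕ → Walk k N) → S}
    (hX : ∀ ρ ρ', (∀ i < s, ρ i = ρ' i) → X ρ = X ρ') (g : S → Walk k N → ℝ) :
    ∫ ρ, g (X ρ) (ρ s) ∂law k N = ∫ ρ, ∫ r, g (X ρ) r ∂walkLaw k N ∂law k N := by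
  let _ : MeasurableSpace S := ⊤
  have hXm : Measurable X := measurable_of_before hX
  have hind : IndepFun X (fun ρ => ρ s) (law k N) := by
    have h0 : iIndepFun (fun (i : ℕ) (ρ : ℕ → Walk k N) => ρ i) (law k N) :=
      iIndepFun_infinitePi (P := fun _ => walkLaw k N) (X := fun _ => id) (fun _ => measurable_id)
    have h1 := h0.indepFun_finset (Finset.range s) {s} (by simp) (fun i => measurable_pi_apply i)
    obtain ⟨φ, rfl⟩ := exists_eq_comp_restrict hX
    exact h1.comp (measurable_of_finite φ)
      (measurable_pi_apply (⟨s, Finset.mem_singleton_self s⟩ : ({s} : Finset ℕ)))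
  have hmap : (law k N).map (fun ρ => ρ s) = walkLaw k N :=
    Measure.infinitePi_map_eval (μ := fun _ => walkLaw k N) s
  have hpair := (indepFun_iff_map_prod_eq_prod_map_map hXm.aemeasurable
    (measurable_pi_apply s).aemeasurable).1 hind
  rw [hmap] at hpair
  have hPX : IsProbabilityMeasure ((law k N).map X) :=
    Measure.isProbabilityMeasure_map hXm.aemeasurable
  have hgm : Measurable (Function.uncurry g) := measurable_of_finite _
  have hgi : Integrable (Function.uncurry g) (((law k N).map X).prod (walkLaw k N)) :=
    .of_finite
  calc ∫ ρ, g (X ρ) (ρ s) ∂law k N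
      = ∫ p, Function.uncurry g p ∂((law k N).map fun ρ => (X ρ, ρ s)) :=
        (integral_map (hXm.prodMk (measurable_pi_apply s)).aemeasurable
          hgm.aestronglyMeasurable).symm
    _ = ∫ x, ∫ r, g x r ∂walkLaw k N ∂(law k N).map X := by
        rw [hpair, integral_prod _ hgi]; rfl
    _ = _ := integral_map hXm.aemeasurable (measurable_of_finite _).aestronglyMeasurable

end Before

/-! ### Hitting probabilities and the relaxed processes. -/

/-- The walk `r` meets an occupied vertex in level `a`; level `k + 1` is the sink. -/
def Hit (B : Finset (Vertex k N)) (r : Walk k N) (a : ℕ) : Prop :=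
  ∀ h : a < k + 1, (⟨⟨a, h⟩, r ⟨a, h⟩⟩ : Vertex k N) ∈ B

lemma nextOccupied_iff_hit {B : Finset (Vertex k N)} {r : Walk k N} {i : Fin (k + 1)} :
    NextOccupied B r i ↔ Hit B r (i + 1) := Iff.rfl

/-- The number of occupied vertices in level `a`, which is `1` for the sink. -/
noncomputable def cnt (B : Finset (Vertex k N)) (a : ℕ) : ℕ :=
  if a < k + 1 then (B.filter fun v => (v.1 : ℕ) = a).card else 1

/-- The number of vertices in level `a`, which is `1` for the sink. -/
def size (k : ℕ) (N : ℕ → ℕ+) (a : ℕ) : ℕ := if a < k + 1 then N a else 1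

lemma size_pos (a : ℕ) : 0 < size k N a := by
  unfold size; split_ifs <;> simp

lemma cnt_mono {B C : Finset (Vertex k N)} (h : B ⊆ C) (a : ℕ) : cnt B a ≤ cnt C a := by
  unfold cnt
  split_ifs
  · exact Finset.card_le_card (Finset.filter_subset_filter _ h)
  · exact le_rfl

lemma hit_setOf_eq {B : Finset (Vertex k N)} {a : ℕ} (h : a < k + 1) :
    {r : Walk k N | Hit B r a} = (fun r => r ⟨a, h⟩) ⁻¹' {x | (⟨⟨a, h⟩, x⟩ : Vertex k N) ∈ B} := by
  ext r
  simp [Hit, h]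

lemma walkLaw_real_hit (B : Finset (Vertex k N)) (a : ℕ) :
    (walkLaw k N).real {r | Hit B r a} = cnt B a / size k N a := by
  by_cases h : a < k + 1
  · rw [hit_setOf_eq h, measureReal_def]
    have hmp := measurePreserving_eval
      (fun i : Fin (k + 1) => uniformOn (Set.univ : Set (Fin (N i)))) ⟨a, h⟩
    have := hmp.measure_preimage (s := {x | (⟨⟨a, h⟩, x⟩ : Vertex k N) ∈ B})
      (Set.toFinite _).measurableSet.nullMeasurableSet
    unfold walkLaw
    erw [this]
    have hc : (B.filter fun v => (v.1 : ℕ) = a).card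
        = Set.ncard {x | (⟨⟨a, h⟩, x⟩ : Vertex k N) ∈ B} := by
      classical
      rw [← Set.ncard_coe_finset]
      have : ((B.filter fun v => (v.1 : ℕ) = a : Finset (Vertex k N)) : Set (Vertex k N))
          = (fun x => (⟨⟨a, h⟩, x⟩ : Vertex k N)) '' {x | (⟨⟨a, h⟩, x⟩ : Vertex k N) ∈ B} := by
        ext ⟨i, x⟩
        simp only [Finset.coe_filter, Set.mem_ofPred_eq, Set.mem_image]
        constructor
        · rintro ⟨h1, h2⟩
          obtain rfl : i = ⟨a, h⟩ := Fin.ext h2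
          exact ⟨x, h1, rfl⟩
        · rintro ⟨y, hy, he⟩
          obtain ⟨rfl, he⟩ := Sigma.mk.inj_iff.1 he
          cases he
          exact ⟨hy, rfl⟩
      rw [this]
      exact Set.ncard_image_of_injective _ fun x y hxy => eq_of_heq (Sigma.mk.inj_iff.1 hxy).2
    rw [cnt, size, if_pos h, if_pos h, hc, uniformOn_univ]
    rw [Measure.count_apply_finite _ (Set.toFinite _), ENNReal.toReal_div,
      Set.ncard_eq_toFinset_card _ (Set.toFinite _)]
    simp
  · have : {r : Walk k N | Hit B r a} = Set.univ := by ext; simp [Hit, h]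
    rw [this, cnt, size, if_neg h, if_neg h]
    simp

/-- Coordinates of the walk at distinct levels are independent; at the sink a hit is certain, so the
formula persists. -/
lemma walkLaw_real_hit_and (B : Finset (Vertex k N)) {a b : ℕ} (hab : a ≠ b) :
    (walkLaw k N).real {r | Hit B r a ∧ Hit B r b} =
      cnt B a / size k N a * (cnt B b / size k N b) := by
  rw [← walkLaw_real_hit, ← walkLaw_real_hit]
  by_cases ha : a < k + 1
  · by_cases hb : b < k + 1
    · have h0 : iIndepFun (fun (i : Fin (k + 1)) (r : Walk k N) => r i) (walkLaw k N) :=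
        iIndepFun_pi (μ := fun i : Fin (k + 1) => uniformOn (Set.univ : Set (Fin (N i))))
          (X := fun _ => id) (fun _ => aemeasurable_id)
      have h1 := h0.indepFun (i := ⟨a, ha⟩) (j := ⟨b, hb⟩) (by simpa using hab)
      have h2 := h1.measure_inter_preimage_eq_mul {x | (⟨⟨a, ha⟩, x⟩ : Vertex k N) ∈ B}
        {x | (⟨⟨b, hb⟩, x⟩ : Vertex k N) ∈ B} (Set.toFinite _).measurableSet
        (Set.toFinite _).measurableSet
      rw [Set.ofPred_and, hit_setOf_eq ha, hit_setOf_eq hb, measureReal_def, h2, ENNReal.toReal_mul]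
      rfl
    · have : ∀ r : Walk k N, Hit B r b := fun r h => absurd h hb
      simp [this]
  · have : ∀ r : Walk k N, Hit B r a := fun r h => absurd h ha
    simp [this]

open Classical in
/-- A step of a relaxed process: a particle is blocked only by vertices in levels at least `A`,
and in the levels before `A` it occupies every vertex from which the next one is occupied. -/
noncomputable def relaxedStep (A : ℕ) (B : Finset (Vertex k N)) (r : Walk k N) :
    Finset (Vertex k N) :=
  B ∪ Finset.univ.filter fun v =>
    v.2 = r v.1 ∧ Hit B r (v.1 + 1) ∧ ∀ b, A ≤ b → b ≤ (v.1 : ℕ) → ¬ Hit B r b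

noncomputable def relaxed (A : ℕ) (ρ : ℕ → Walk k N) : ℕ → Finset (Vertex k N)
  | 0 => ∅
  | t + 1 => relaxedStep A (relaxed A ρ t) (ρ t)

/-- A step of the relaxed process occupies a new vertex in level `a`. -/
def Grows (A : ℕ) (B : Finset (Vertex k N)) (r : Walk k N) (a : ℕ) : Prop :=
  Hit B r (a + 1) ∧ (∀ b, A ≤ b → b ≤ a → ¬ Hit B r b) ∧ ¬ Hit B r a

lemma relaxed_congr (A : ℕ) (s : ℕ) (ρ ρ' : ℕ → Walk k N) (h : ∀ i < s, ρ i = ρ' i) :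
    relaxed A ρ s = relaxed A ρ' s := by
  induction s with
  | zero => rfl
  | succ s ih =>
    rw [relaxed, relaxed, ih fun i hi => h i (by omega), h s (by omega)]

lemma occupied_congr (s : ℕ) (ρ ρ' : ℕ → Walk k N) (h : ∀ i < s, ρ i = ρ' i) :
    occupied ρ s = occupied ρ' s := by
  induction s with
  | zero => rfl
  | succ s ih =>
    rw [occupied, occupied, ih fun i hi => h i (by omega), h s (by omega)]

open Classical in
lemma cnt_relaxedStep {A a : ℕ} (ha : a < k + 1) (B : Finset (Vertex k N)) (r : Walk k N) :
    cnt (relaxedStep A B r) a = cnt B a + if Grows A B r a then 1 else 0 := by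
  unfold cnt relaxedStep
  rw [if_pos ha, if_pos ha, Finset.filter_union]
  by_cases hg : Hit B r (a + 1) ∧ ∀ b, A ≤ b → b ≤ a → ¬ Hit B r b
  · have hS : (Finset.univ.filter fun v : Vertex k N =>
        v.2 = r v.1 ∧ Hit B r (v.1 + 1) ∧ ∀ b, A ≤ b → b ≤ (v.1 : ℕ) → ¬ Hit B r b).filter
          (fun v => (v.1 : ℕ) = a) = {⟨⟨a, ha⟩, r ⟨a, ha⟩⟩} := by
      ext ⟨i, x⟩
      simp only [Finset.mem_filter, Finset.mem_univ, true_and, Finset.mem_singleton]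
      constructor
      · rintro ⟨⟨h1, -⟩, h2⟩
        obtain rfl : i = ⟨a, ha⟩ := Fin.ext h2
        simp only at h1
        rw [h1]
      · intro h
        obtain ⟨rfl, h⟩ := Sigma.mk.inj_iff.1 h
        cases h
        exact ⟨⟨rfl, hg⟩, rfl⟩
    rw [hS]
    by_cases hB : (⟨⟨a, ha⟩, r ⟨a, ha⟩⟩ : Vertex k N) ∈ B
    · rw [if_neg fun h => h.2.2 fun _ => hB, Finset.union_eq_left.2]
      · rfl
      · simp [hB]
    · rw [if_pos ⟨hg.1, hg.2, fun h => hB (h ha)⟩, Finset.card_union_of_disjoint]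
      · simp
      · simp [hB]
  · have hS : (Finset.univ.filter fun v : Vertex k N =>
        v.2 = r v.1 ∧ Hit B r (v.1 + 1) ∧ ∀ b, A ≤ b → b ≤ (v.1 : ℕ) → ¬ Hit B r b).filter
          (fun v => (v.1 : ℕ) = a) = ∅ := by
      ext ⟨i, x⟩
      simp only [Finset.mem_filter, Finset.mem_univ, true_and, Finset.notMem_empty, iff_false]
      rintro ⟨⟨-, h1, h2⟩, rfl⟩
      exact hg ⟨h1, h2⟩
    rw [hS, if_neg fun h => hg ⟨h.1, h.2.1⟩]
    simp

lemma walkLaw_real_grows_le (A : ℕ) (B : Finset (Vertex k N)) (a : ℕ) :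
    (walkLaw k N).real {r | Grows A B r a} ≤ cnt B (a + 1) / size k N (a + 1) := by
  rw [← walkLaw_real_hit]
  exact measureReal_mono fun r h => h.1

lemma walkLaw_real_grows_and_le (A : ℕ) (B : Finset (Vertex k N)) {a b : ℕ} (hab : a ≠ b) :
    (walkLaw k N).real {r | Grows A B r a ∧ Grows A B r b} ≤
      cnt B (a + 1) / size k N (a + 1) * (cnt B (b + 1) / size k N (b + 1)) := by
  rw [← walkLaw_real_hit_and B (a := a + 1) (b := b + 1) (by omega)]
  exact measureReal_mono fun r h => ⟨h.1.1, h.2.1⟩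

/-- Union bound over the levels that could block. Each blocking hit is at a level other than a + 1,
hence independent of the hit there. Any A ≥ A₀ is allowed, so one estimate serves both relaxed
processes. -/
lemma le_walkLaw_real_grows {A A₀ : ℕ} (hA : A₀ ≤ A) (B : Finset (Vertex k N)) {a : ℕ}
    (ha : A₀ ≤ a) :
    cnt B (a + 1) / size k N (a + 1) * (1 - ∑ b ∈ Finset.Icc A₀ a, (cnt B b : ℝ) / size k N b) ≤
      (walkLaw k N).real {r | Grows A B r a} := by
  have h1 : {r : Walk k N | Hit B r (a + 1)} ⊆
      {r | Grows A B r a} ∪ ⋃ b ∈ Finset.Icc A₀ a, {r | Hit B r (a + 1) ∧ Hit B r b} := by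
    intro r hr
    by_cases hg : Grows A B r a
    · exact Or.inl hg
    · right
      simp only [Set.mem_iUnion]
      by_contra! hcon
      refine hg ⟨hr, fun b hb hba hit => ?_, fun hit => ?_⟩
      · exact hcon b (Finset.mem_Icc.2 ⟨hA.trans hb, hba⟩) ⟨hr, hit⟩
      · exact hcon a (Finset.mem_Icc.2 ⟨ha, le_rfl⟩) ⟨hr, hit⟩
  have h2 := measureReal_mono (μ := walkLaw k N) h1
  have h3 := h2.trans (measureReal_union_le _ _)
  have h4 : (walkLaw k N).real (⋃ b ∈ Finset.Icc A₀ a, {r | Hit B r (a + 1) ∧ Hit B r b}) ≤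
      ∑ b ∈ Finset.Icc A₀ a,
        (cnt B (a + 1) : ℝ) / size k N (a + 1) * (cnt B b / size k N b) := by
    refine (measureReal_biUnion_finset_le _ _).trans (Finset.sum_le_sum fun b hb => ?_)
    rw [Finset.mem_Icc] at hb
    rw [walkLaw_real_hit_and B (by omega)]
  rw [walkLaw_real_hit] at h3
  rw [mul_sub, mul_one, Finset.mul_sum]
  linarith

/-! ### Depth coordinates; first and second moments of the relaxed processes. -/

/-- The number of occupied vertices at depth `a`; the sink is at depth `0`. -/
noncomputable def pop (B : Finset (Vertex k N)) (a : ℕ) : ℝ := cnt B (k + 1 - a)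

/-- The number of vertices at depth `a`. -/
noncomputable def width (k : ℕ) (N : ℕ → ℕ+) (a : ℕ) : ℝ := size k N (k + 1 - a)

lemma width_pos (a : ℕ) : 0 < width k N a := by
  unfold width; exact_mod_cast size_pos _

lemma pop_zero (B : Finset (Vertex k N)) : pop B 0 = 1 := by simp [pop, cnt]

lemma pop_nonneg (B : Finset (Vertex k N)) (a : ℕ) : 0 ≤ pop B a := by simp [pop]

lemma pop_empty {a : ℕ} (ha : a ≠ 0) : pop (∅ : Finset (Vertex k N)) a = 0 := by
  simp [pop, cnt]; omega

open Classical in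
lemma pop_relaxedStep (A a : ℕ) (B : Finset (Vertex k N)) (r : Walk k N) :
    pop (relaxedStep A B r) (a + 1)
      = pop B (a + 1) + if Grows A B r (k - a) then 1 else 0 := by
  unfold pop
  rw [Nat.add_sub_add_right, cnt_relaxedStep (by omega)]
  push_cast
  rfl

lemma cnt_div_size {a : ℕ} (ha : a ≤ k) (B : Finset (Vertex k N)) :
    (cnt B (k - a + 1) : ℝ) / size k N (k - a + 1) = pop B a / width k N a := by
  rw [pop, width, show k + 1 - a = k - a + 1 by omega]

lemma integral_ite_walkLaw (p : Walk k N → Prop) [DecidablePred p] :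
    ∫ r, (if p r then (1 : ℝ) else 0) ∂walkLaw k N = (walkLaw k N).real {r | p r} := by
  classical
  rw [← integral_indicator_one (Set.toFinite {r | p r}).measurableSet]
  congr 1
  funext r
  simp [Set.indicator]

noncomputable def meanPop (A k : ℕ) (N : ℕ → ℕ+) (a s : ℕ) : ℝ :=
  ∫ ρ, pop (relaxed A ρ s) a ∂law k N

noncomputable def momentPop (A k : ℕ) (N : ℕ → ℕ+) (a b s : ℕ) : ℝ :=
  ∫ ρ, pop (relaxed A ρ s) a * pop (relaxed A ρ s) b ∂law k N

lemma integrable_relaxed (A s : ℕ) (f : Finset (Vertex k N) → ℝ) :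
    Integrable (fun ρ => f (relaxed A ρ s)) (law k N) :=
  integrable_of_before fun ρ ρ' h => by rw [relaxed_congr A s ρ ρ' h]

lemma integral_relaxed_succ (A s : ℕ) (f : Finset (Vertex k N) → ℝ) :
    ∫ ρ, f (relaxed A ρ (s + 1)) ∂law k N =
      ∫ ρ, ∫ r, f (relaxedStep A (relaxed A ρ s) r) ∂walkLaw k N ∂law k N :=
  integral_before_next (relaxed_congr A s) fun B r => f (relaxedStep A B r)

lemma meanPop_zero_left (A s : ℕ) : meanPop A k N 0 s = 1 := by simp [meanPop, pop_zero]

lemma momentPop_zero_left (A b s : ℕ) : momentPop A k N 0 b s = meanPop A k N b s := by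
  simp [meanPop, momentPop, pop_zero]

lemma momentPop_zero_right (A a s : ℕ) : momentPop A k N a 0 s = meanPop A k N a s := by
  simp [meanPop, momentPop, pop_zero]

lemma integral_pop_relaxedStep (A a : ℕ) (B : Finset (Vertex k N)) :
    ∫ r, pop (relaxedStep A B r) (a + 1) ∂walkLaw k N
      = pop B (a + 1) + (walkLaw k N).real {r | Grows A B r (k - a)} := by
  classical
  simp only [pop_relaxedStep]
  rw [integral_add .of_finite .of_finite, integral_ite_walkLaw]
  simp

lemma meanPop_succ_le {A a s : ℕ} (ha : a ≤ k) :
    meanPop A k N (a + 1) (s + 1) ≤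
      meanPop A k N (a + 1) s + meanPop A k N a s / width k N a := by
  unfold meanPop
  rw [integral_relaxed_succ A s (fun B => pop B (a + 1)), ← integral_div,
    ← integral_add (integrable_relaxed A s (fun B => pop B (a + 1)))
      (integrable_relaxed A s (fun B => pop B a / width k N a))]
  refine integral_mono
    (integrable_relaxed A s fun B => ∫ r, pop (relaxedStep A B r) (a + 1) ∂walkLaw k N)
    (integrable_relaxed A s fun B => pop B (a + 1) + pop B a / width k N a) fun ρ => ?_
  simp only
  rw [integral_pop_relaxedStep, ← cnt_div_size ha]
  gcongr
  exact walkLaw_real_grows_le _ _ _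

/-- Averaging `le_walkLaw_real_grows` over the past turns the blocking loss into mixed moments,
which `pairBound` controls. -/
lemma le_meanPop_succ {A H a s : ℕ} (hA : k + 1 - H ≤ A) (ha : a + 1 ≤ H) (hH : H ≤ k) :
    meanPop A k N (a + 1) s + (meanPop A k N a s -
        ∑ b ∈ Finset.Icc (a + 1) H, momentPop A k N a b s / width k N b) / width k N a ≤
      meanPop A k N (a + 1) (s + 1) := by
  have hpt : ∀ B : Finset (Vertex k N),
      pop B (a + 1) + (pop B a - ∑ b ∈ Finset.Icc (a + 1) H, pop B a * pop B b / width k N b)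
        / width k N a ≤ ∫ r, pop (relaxedStep A B r) (a + 1) ∂walkLaw k N := by
    intro B
    rw [integral_pop_relaxedStep]
    have h := le_walkLaw_real_grows (A₀ := k + 1 - H) hA B (a := k - a) (by omega)
    rw [cnt_div_size (by omega)] at h
    have e : ∑ b ∈ Finset.Icc (k + 1 - H) (k - a), (cnt B b : ℝ) / size k N b =
        ∑ b ∈ Finset.Icc (a + 1) H, pop B b / width k N b := by
      refine Finset.sum_nbij' (fun b => k + 1 - b) (fun b => k + 1 - b) ?_ ?_ ?_ ?_ ?_
      all_goals intro b hb
      all_goals rw [Finset.mem_Icc] at hb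
      · rw [Finset.mem_Icc]; omega
      · rw [Finset.mem_Icc]; omega
      · omega
      · omega
      · rw [pop, width, show k + 1 - (k + 1 - b) = b by omega]
    rw [e] at h
    refine le_trans (le_of_eq ?_) (add_le_add_right h _)
    simp only [mul_div_assoc, ← Finset.mul_sum]
    ring
  have hI := integral_mono
    (integrable_relaxed A s fun B => pop B (a + 1) +
      (pop B a - ∑ b ∈ Finset.Icc (a + 1) H, pop B a * pop B b / width k N b) / width k N a)
    (integrable_relaxed A s fun B => ∫ r, pop (relaxedStep A B r) (a + 1) ∂walkLaw k N)
    (fun ρ => hpt (relaxed A ρ s))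
  rw [← integral_relaxed_succ A s (fun B => pop B (a + 1))] at hI
  refine le_trans (le_of_eq ?_) hI
  unfold meanPop momentPop
  rw [integral_add (integrable_relaxed A s fun B => pop B (a + 1)) (integrable_relaxed A s fun B =>
      (pop B a - ∑ b ∈ Finset.Icc (a + 1) H, pop B a * pop B b / width k N b) / width k N a),
    integral_div, integral_sub (integrable_relaxed A s fun B => pop B a)
      (integrable_relaxed A s fun B =>
        ∑ b ∈ Finset.Icc (a + 1) H, pop B a * pop B b / width k N b),
    integral_finsetSum _ fun b _ => integrable_relaxed A s fun B =>
      pop B a * pop B b / width k N b]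
  simp only [integral_div]

lemma momentPop_succ_eq (A a b s : ℕ) :
    momentPop A k N (a + 1) (b + 1) (s + 1) = ∫ ρ, (pop (relaxed A ρ s) (a + 1) *
      pop (relaxed A ρ s) (b + 1) +
      pop (relaxed A ρ s) (b + 1) * (walkLaw k N).real {r | Grows A (relaxed A ρ s) r (k - a)} +
      pop (relaxed A ρ s) (a + 1) * (walkLaw k N).real {r | Grows A (relaxed A ρ s) r (k - b)} +
      (walkLaw k N).real {r | Grows A (relaxed A ρ s) r (k - a) ∧
        Grows A (relaxed A ρ s) r (k - b)}) ∂law k N := by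
  classical
  unfold momentPop
  rw [integral_relaxed_succ A s (fun B => pop B (a + 1) * pop B (b + 1))]
  congr 1
  funext ρ
  simp only [pop_relaxedStep]
  have e : ∀ r : Walk k N, (pop (relaxed A ρ s) (a + 1) +
        if Grows A (relaxed A ρ s) r (k - a) then (1 : ℝ) else 0) *
      (pop (relaxed A ρ s) (b + 1) + if Grows A (relaxed A ρ s) r (k - b) then (1 : ℝ) else 0) =
      pop (relaxed A ρ s) (a + 1) * pop (relaxed A ρ s) (b + 1) +
      pop (relaxed A ρ s) (b + 1) * (if Grows A (relaxed A ρ s) r (k - a) then (1 : ℝ) else 0) +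
      pop (relaxed A ρ s) (a + 1) * (if Grows A (relaxed A ρ s) r (k - b) then (1 : ℝ) else 0) +
      (if Grows A (relaxed A ρ s) r (k - a) ∧ Grows A (relaxed A ρ s) r (k - b)
        then (1 : ℝ) else 0) := by
    intro r
    by_cases h1 : Grows A (relaxed A ρ s) r (k - a) <;>
      by_cases h2 : Grows A (relaxed A ρ s) r (k - b) <;> simp [h1, h2] <;> ring
  simp only [e]
  rw [integral_add .of_finite .of_finite, integral_add .of_finite .of_finite,
    integral_add .of_finite .of_finite]
  simp only [integral_const_mul]
  rw [integral_ite_walkLaw, integral_ite_walkLaw, integral_ite_walkLaw]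
  simp

/-- Growth at two different depths requires hits at two different levels, so given the past the
joint probability is at most the product. -/
lemma momentPop_succ_le {A a b s : ℕ} (ha : a ≤ k) (hb : b ≤ k) (hab : a ≠ b) :
    momentPop A k N (a + 1) (b + 1) (s + 1) ≤ momentPop A k N (a + 1) (b + 1) s +
      momentPop A k N a (b + 1) s / width k N a + momentPop A k N (a + 1) b s / width k N b +
      momentPop A k N a b s / (width k N a * width k N b) := by
  rw [momentPop_succ_eq]
  unfold momentPop
  simp only [← integral_div]
  rw [← integral_add (integrable_relaxed A s fun B => pop B (a + 1) * pop B (b + 1))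
      (integrable_relaxed A s fun B => pop B a * pop B (b + 1) / width k N a),
    ← integral_add (integrable_relaxed A s fun B => pop B (a + 1) * pop B (b + 1) +
        pop B a * pop B (b + 1) / width k N a)
      (integrable_relaxed A s fun B => pop B (a + 1) * pop B b / width k N b),
    ← integral_add (integrable_relaxed A s fun B => pop B (a + 1) * pop B (b + 1) +
        pop B a * pop B (b + 1) / width k N a + pop B (a + 1) * pop B b / width k N b)
      (integrable_relaxed A s fun B => pop B a * pop B b / (width k N a * width k N b))]
  refine integral_mono
    (integrable_relaxed A s fun B => pop B (a + 1) * pop B (b + 1) +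
      pop B (b + 1) * (walkLaw k N).real {r | Grows A B r (k - a)} +
      pop B (a + 1) * (walkLaw k N).real {r | Grows A B r (k - b)} +
      (walkLaw k N).real {r | Grows A B r (k - a) ∧ Grows A B r (k - b)})
    (integrable_relaxed A s fun B => pop B (a + 1) * pop B (b + 1) +
        pop B a * pop B (b + 1) / width k N a + pop B (a + 1) * pop B b / width k N b +
        pop B a * pop B b / (width k N a * width k N b)) fun ρ => ?_
  simp only
  set B := relaxed A ρ s
  have h1 := walkLaw_real_grows_le A B (k - a)
  have h2 := walkLaw_real_grows_le A B (k - b)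
  have h3 := walkLaw_real_grows_and_le A B (a := k - a) (b := k - b) (by omega)
  rw [cnt_div_size ha, cnt_div_size hb] at h3
  rw [cnt_div_size ha] at h1
  rw [cnt_div_size hb] at h2
  have h4 := mul_le_mul_of_nonneg_left h1 (pop_nonneg B (b + 1))
  have h5 := mul_le_mul_of_nonneg_left h2 (pop_nonneg B (a + 1))
  have e1 : pop B (b + 1) * (pop B a / width k N a) = pop B a * pop B (b + 1) / width k N a := by
    ring
  have e2 : pop B (a + 1) * (pop B b / width k N b) = pop B (a + 1) * pop B b / width k N b := by
    ring
  have e3 : pop B a / width k N a * (pop B b / width k N b) =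
      pop B a * pop B b / (width k N a * width k N b) := by rw [div_mul_div_comm]
  linarith

/-- On the diagonal both growths are the same event, so the last term is linear in the population;
writing it as a moment with depth 0 keeps the recursion closed. -/
lemma momentPop_self_succ_le {A a s : ℕ} (ha : a ≤ k) :
    momentPop A k N (a + 1) (a + 1) (s + 1) ≤ momentPop A k N (a + 1) (a + 1) s +
      momentPop A k N a (a + 1) s / width k N a + momentPop A k N (a + 1) a s / width k N a +
      momentPop A k N 0 a s / width k N a := by
  rw [momentPop_succ_eq]
  unfold momentPop
  simp only [← integral_div, pop_zero, one_mul]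
  rw [← integral_add (integrable_relaxed A s fun B => pop B (a + 1) * pop B (a + 1))
      (integrable_relaxed A s fun B => pop B a * pop B (a + 1) / width k N a),
    ← integral_add (integrable_relaxed A s fun B => pop B (a + 1) * pop B (a + 1) +
        pop B a * pop B (a + 1) / width k N a)
      (integrable_relaxed A s fun B => pop B (a + 1) * pop B a / width k N a),
    ← integral_add (integrable_relaxed A s fun B => pop B (a + 1) * pop B (a + 1) +
        pop B a * pop B (a + 1) / width k N a + pop B (a + 1) * pop B a / width k N a)
      (integrable_relaxed A s fun B => pop B a / width k N a)]
  refine integral_mono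
    (integrable_relaxed A s fun B => pop B (a + 1) * pop B (a + 1) +
      pop B (a + 1) * (walkLaw k N).real {r | Grows A B r (k - a)} +
      pop B (a + 1) * (walkLaw k N).real {r | Grows A B r (k - a)} +
      (walkLaw k N).real {r | Grows A B r (k - a) ∧ Grows A B r (k - a)})
    (integrable_relaxed A s fun B => pop B (a + 1) * pop B (a + 1) +
        pop B a * pop B (a + 1) / width k N a + pop B (a + 1) * pop B a / width k N a +
        pop B a / width k N a) fun ρ => ?_
  simp only
  set B := relaxed A ρ s
  have h1 := walkLaw_real_grows_le A B (k - a)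
  rw [cnt_div_size ha] at h1
  have h4 := mul_le_mul_of_nonneg_left h1 (pop_nonneg B (a + 1))
  have e1 : pop B (a + 1) * (pop B a / width k N a) = pop B a * pop B (a + 1) / width k N a := by
    ring
  have e2 : pop B (a + 1) * pop B a / width k N a = pop B a * pop B (a + 1) / width k N a := by
    ring
  simp only [and_self]
  linarith

lemma momentPop_le {A H a b s : ℕ} (hH : H ≤ k) (ha : a ≤ H) (hb : b ≤ H) :
    momentPop A k N a b s ≤ pairBound (width k N) H a b s := by
  refine moment_le_pairBound (fun a => width_pos a) (M := momentPop A k N) ?_ ?_ ?_ ?_ ?_ ?_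
    s a b ha hb
  · intro a b
    unfold momentPop
    simp only [relaxed]
    rcases a with _ | a
    · rcases b with _ | b
      · simp [pop_zero]
      · simp [pop_empty]
    · simp [pop_empty]
  · intro s
    rw [momentPop_zero_left, meanPop_zero_left]
  · intro b s hb
    simp only [momentPop_zero_left]
    exact meanPop_succ_le (by omega)
  · intro b s hb
    simp only [momentPop_zero_right]
    exact meanPop_succ_le (by omega)
  · intro a b s ha hb hab
    exact momentPop_succ_le (by omega) (by omega) hab
  · intro a s ha
    exact momentPop_self_succ_le (by omega)

/-- Second moment bound for the relaxed processes. -/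
lemma integral_sub_nu_sq_le {A H a s t : ℕ} (hA : k + 1 - H ≤ A) (hH : H ≤ k)
    (ha : a ≤ H) (hs : 0 < s) (hst : s ≤ t) (hdec : Decreasing (width k N) H t)
    (hone : ∀ g < a, 1 ≤ nu (width k N) g t) :
    ∫ ρ, (pop (relaxed A ρ s) a - nu (width k N) a s) ^ 2 ∂law k N ≤
      nu (width k N) a s ^ 2 * (16 / nu (width k N) a s +
        4 * (a * (4 ^ H * ∑ b ∈ Finset.Icc 1 H, nu (width k N) b t / width k N b))
          + 2 * a ^ 2 / s) := by
  set n := width k N with hn_def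
  have hn : ∀ a, 0 < n a := fun a => width_pos a
  set lam := ∑ b ∈ Finset.Icc 1 H, nu n b t / n b with hlam
  have hs' : (0 : ℝ) < s := by exact_mod_cast hs
  have hst' : (s : ℝ) ≤ t := by exact_mod_cast hst
  have ht' : (0 : ℝ) < t := hs'.trans_le hst'
  have hlam0 : 0 ≤ lam := Finset.sum_nonneg fun b _ =>
    div_nonneg (nu_nonneg hn b ht'.le) (hn b).le
  have hN := nu_pos hn a hs'
  have h2 : momentPop A k N a a s ≤ nu n a s ^ 2 * (1 + 16 / nu n a s) :=
    (momentPop_le hH ha ha).trans (pairBound_self_le hn (hdec.mono hst') hs' ha)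
  have h1 : s.choose a / weight n a - a * (2 * 4 ^ H * lam) * nu n a s ≤ meanPop A k N a s := by
    refine le_mean_of_recursion hn (t := s) (c := a) (m := meanPop A k N)
      (L := 2 * 4 ^ H * lam) (by positivity) ?_ ?_ ?_ s a le_rfl le_rfl
    · intro b
      exact integral_nonneg fun ρ => pop_nonneg _ _
    · intro s
      rw [meanPop_zero_left]
    · intro b u hb hu
      refine le_trans ?_ (le_meanPop_succ hA (show b + 1 ≤ H by omega) hH)
      have hu' : (u : ℝ) ≤ t := hst'.trans' (by exact_mod_cast hu.le)
      -- The expected loss by blocking is a multiple of ν_b(u) itself, hence a relative error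
      -- uniform in the time u, as `le_mean_of_recursion` needs.
      have hsum : ∑ c ∈ Finset.Icc (b + 1) H, momentPop A k N b c u / n c ≤
          2 * 4 ^ H * lam * nu n b u := by
        calc ∑ c ∈ Finset.Icc (b + 1) H, momentPop A k N b c u / n c
            ≤ ∑ c ∈ Finset.Icc (b + 1) H, 2 * 4 ^ H * nu n b u * (nu n c t / n c) := by
              refine Finset.sum_le_sum fun c hc => ?_
              rw [Finset.mem_Icc] at hc
              have h := (momentPop_le (A := A) (N := N) (s := u) hH
                (show b ≤ H by omega) hc.2).trans
                (pairBound_le hn (show b ≤ H by omega) hc.2 (Nat.cast_nonneg u) ht' hu'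
                  fun g hg => hone g (by omega))
              rw [← mul_div_assoc]
              refine div_le_div_of_nonneg_right ?_ (hn c).le
              linarith
          _ ≤ 2 * 4 ^ H * nu n b u * lam := by
              rw [← Finset.mul_sum]
              refine mul_le_mul_of_nonneg_left ?_
                (mul_nonneg (by positivity) (nu_nonneg hn b (Nat.cast_nonneg u)))
              refine Finset.sum_le_sum_of_subset_of_nonneg ?_ fun c _ _ =>
                div_nonneg (nu_nonneg hn c ht'.le) (hn c).le
              exact Finset.Icc_subset_Icc_left (by omega)
          _ = _ := by ring
      gcongr
      exact (hn b).le
  have h3 := one_sub_sq_div_mul_nu_le hn a hs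
  -- The square is centred at ν rather than at the mean, so an upper bound for the second moment and
  -- a lower bound for the mean suffice.
  have hint : ∫ ρ, (pop (relaxed A ρ s) a - nu n a s) ^ 2 ∂law k N =
      momentPop A k N a a s - 2 * nu n a s * meanPop A k N a s + nu n a s ^ 2 := by
    unfold momentPop meanPop
    have e : ∀ ρ : ℕ → Walk k N, (pop (relaxed A ρ s) a - nu n a s) ^ 2 =
        pop (relaxed A ρ s) a * pop (relaxed A ρ s) a -
          2 * nu n a s * pop (relaxed A ρ s) a + nu n a s ^ 2 := fun ρ => by ring
    simp only [e]
    rw [integral_add (integrable_relaxed A s fun B =>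
        pop B a * pop B a - 2 * nu n a s * pop B a) (integrable_const _),
      integral_sub (integrable_relaxed A s fun B => pop B a * pop B a)
        (integrable_relaxed A s fun B => 2 * nu n a s * pop B a), integral_const_mul]
    simp
  rw [hint]
  have h4 : (1 - (a : ℝ) ^ 2 / s - a * (2 * 4 ^ H * lam)) * nu n a s ≤ meanPop A k N a s := by
    linarith
  have h5 := mul_le_mul_of_nonneg_left h4 (show 0 ≤ 2 * nu n a s by positivity)
  have e : nu n a s ^ 2 * (16 / nu n a s + 4 * (a * (4 ^ H * lam)) + 2 * a ^ 2 / s) =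
      nu n a s ^ 2 * (1 + 16 / nu n a s)
        - 2 * nu n a s * ((1 - (a : ℝ) ^ 2 / s - a * (2 * 4 ^ H * lam)) * nu n a s)
        + nu n a s ^ 2 := by ring
  rw [e]
  linarith

/-- The relaxed processes are concentrated. -/
lemma law_real_abs_sub_nu_ge_le {A H a s t : ℕ} (hA : k + 1 - H ≤ A) (hH : H ≤ k)
    (ha : a ≤ H) (hs : 0 < s) (hst : s ≤ t) (hdec : Decreasing (width k N) H t)
    (hone : ∀ g < a, 1 ≤ nu (width k N) g t) {δ : ℝ} (hδ : 0 < δ) :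
    (law k N).real {ρ | δ * nu (width k N) a s ≤
        |pop (relaxed A ρ s) a - nu (width k N) a s|} ≤
      (16 / nu (width k N) a s +
        4 * (a * (4 ^ H * ∑ b ∈ Finset.Icc 1 H, nu (width k N) b t / width k N b))
          + 2 * a ^ 2 / s) / δ ^ 2 := by
  have hN := nu_pos (fun a => width_pos (k := k) (N := N) a) a (show (0 : ℝ) < s by exact_mod_cast hs)
  have h1 := integral_sub_nu_sq_le hA hH ha hs hst hdec hone
  have h2 := mul_meas_ge_le_integral_of_nonneg (μ := law k N)
    (f := fun ρ => (pop (relaxed A ρ s) a - nu (width k N) a s) ^ 2)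
    (ae_of_all _ fun ρ => sq_nonneg _)
    (integrable_relaxed A s fun B => (pop B a - nu (width k N) a s) ^ 2)
    ((δ * nu (width k N) a s) ^ 2)
  have e : {ρ : ℕ → Walk k N | δ * nu (width k N) a s ≤
        |pop (relaxed A ρ s) a - nu (width k N) a s|} =
      {ρ | (δ * nu (width k N) a s) ^ 2 ≤ (pop (relaxed A ρ s) a - nu (width k N) a s) ^ 2} := by
    ext ρ
    simp only [Set.mem_ofPred_eq]
    rw [sq_le_sq, abs_of_pos (mul_pos hδ hN)]
  rw [e, le_div_iff₀ (by positivity)]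
  have h3 := h2.trans h1
  rw [mul_pow] at h3 ⊢
  have hN2 : 0 < nu (width k N) a s ^ 2 := by positivity
  refine le_of_mul_le_mul_left (le_of_eq_of_le ?_ h3) hN2
  ring

/-! ### Comparison of the true process with the relaxed ones. -/

lemma Hit.mono {B C : Finset (Vertex k N)} (h : B ⊆ C) {r : Walk k N} {a : ℕ} (hB : Hit B r a) :
    Hit C r a := fun ha => h (hB ha)

lemma subset_step (B : Finset (Vertex k N)) (r : Walk k N) : B ⊆ step B r := by
  unfold step
  split_ifs
  · exact subset_rfl
  · exact Finset.subset_union_left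

lemma occupied_mono (ρ : ℕ → Walk k N) : Monotone (occupied ρ) :=
  monotone_nat_of_le_succ fun _ => subset_step _ _

lemma pop_mono {B C : Finset (Vertex k N)} (h : B ⊆ C) (a : ℕ) : pop B a ≤ pop C a := by
  unfold pop; exact_mod_cast cnt_mono h _

/-- Without blocking, at least as many vertices are occupied. -/
lemma occupied_subset_relaxed (ρ : ℕ → Walk k N) (t : ℕ) :
    occupied ρ t ⊆ relaxed (k + 1) ρ t := by
  induction t with
  | zero => exact subset_rfl
  | succ t ih =>
    rw [occupied, relaxed, step]
    split_ifs
    · exact ih.trans Finset.subset_union_left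
    · refine Finset.union_subset_union ih fun v hv => ?_
      simp only [Finset.mem_filter, Finset.mem_univ, true_and] at hv ⊢
      refine ⟨hv.2, Hit.mono ih (nextOccupied_iff_hit.1 hv.1.1), fun b h1 h2 => ?_⟩
      have := v.1.2
      omega

/-- A particle halts only in front of an occupied vertex, so the occupied levels form an interval
ending at level k. In particular an empty depth H + 1 means that everything beyond is empty. -/
lemma exists_next_of_mem_occupied {ρ : ℕ → Walk k N} {t : ℕ} {v : Vertex k N}
    (hv : v ∈ occupied ρ t) (hk : (v.1 : ℕ) + 1 < k + 1) :
    ∃ w ∈ occupied ρ t, (w.1 : ℕ) = v.1 + 1 := by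
  classical
  induction t with
  | zero => simp [occupied] at hv
  | succ t ih =>
    have hsub : occupied ρ t ⊆ occupied ρ (t + 1) := subset_step _ _
    by_cases hvt : v ∈ occupied ρ t
    · obtain ⟨w, hw, hwv⟩ := ih hvt
      exact ⟨w, hsub hw, hwv⟩
    · rw [occupied, step] at hv
      split_ifs at hv with hs
      · exact absurd hv hvt
      · simp only [Finset.mem_union, hvt, false_or, Finset.mem_filter, Finset.mem_univ,
          true_and] at hv
        exact ⟨_, hsub (hv.1.1 hk), rfl⟩

lemma pop_pos_iff {B : Finset (Vertex k N)} {a : ℕ} (ha : a ≠ 0) :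
    0 < pop B a ↔ ∃ v ∈ B, (v.1 : ℕ) = k + 1 - a := by
  unfold pop cnt
  rw [if_pos (by omega), Nat.cast_pos, Finset.card_pos]
  constructor
  · rintro ⟨v, hv⟩
    exact ⟨v, (Finset.mem_filter.1 hv).1, (Finset.mem_filter.1 hv).2⟩
  · rintro ⟨v, h1, h2⟩
    exact ⟨v, Finset.mem_filter.2 ⟨h1, h2⟩⟩

lemma one_le_pop {B : Finset (Vertex k N)} {a : ℕ} (h : 0 < pop B a) : 1 ≤ pop B a := by
  unfold pop at *
  exact_mod_cast h

lemma lt_level_of_pop_eq_zero {ρ : ℕ → Walk k N} {t H : ℕ}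
    (h : pop (occupied ρ t) (H + 1) = 0) {v : Vertex k N} (hv : v ∈ occupied ρ t) :
    k - H < (v.1 : ℕ) := by
  by_contra! hle
  have key : ∀ d : ℕ, ∀ v ∈ occupied ρ t, (v.1 : ℕ) + d = k - H →
      ∃ w ∈ occupied ρ t, (w.1 : ℕ) = k - H := by
    intro d
    induction d with
    | zero => exact fun v hv he => ⟨v, hv, he⟩
    | succ d ih =>
      intro v hv he
      obtain ⟨w, hw, hwv⟩ := exists_next_of_mem_occupied hv (by omega)
      exact ih w hw (by omega)
  obtain ⟨w, hw, hwv⟩ := key (k - H - v.1) v hv (by omega)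
  have : 0 < pop (occupied ρ t) (H + 1) :=
    (pop_pos_iff (by omega)).2 ⟨w, hw, by omega⟩
  linarith

/-- As long as depth `H + 1` is empty, blocking from there on plays no role. -/
lemma occupied_eq_relaxed {ρ : ℕ → Walk k N} {t H : ℕ} (hH : H ≤ k)
    (h : pop (occupied ρ t) (H + 1) = 0) :
    occupied ρ t = relaxed (k + 1 - H) ρ t := by
  classical
  induction t with
  | zero => rfl
  | succ t ih =>
    have h0 : pop (occupied ρ t) (H + 1) = 0 :=
      le_antisymm ((pop_mono (subset_step _ _) _).trans h.le) (pop_nonneg _ _)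
    have hlev : ∀ v ∈ occupied ρ t, k - H < (v.1 : ℕ) := fun v hv => lt_level_of_pop_eq_zero h0 hv
    rw [occupied, relaxed, ← ih h0, step, if_neg, relaxedStep]
    · congr 1
      ext v
      simp only [Finset.mem_filter, Finset.mem_univ, true_and]
      rw [and_comm]
      refine and_congr_right fun _ => and_congr_right fun _ => ⟨fun hb b h1 h2 hit => ?_,
        fun hb i' hi' hn => ?_⟩
      · have := v.1.2
        refine hb ⟨b - 1, by omega⟩ (Fin.lt_def.2 (by simp only; omega)) ?_
        rw [nextOccupied_iff_hit]
        simpa [show b - 1 + 1 = b by omega] using hit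
      · rw [nextOccupied_iff_hit] at hn
        have := v.1.2
        have hlt := Fin.lt_def.1 hi'
        -- Hits at levels below k + 1 - H cannot occur, since those levels are empty; the remaining
        -- ones are exactly those at which the relaxed process blocks.
        by_cases hA : k + 1 - H ≤ (i' : ℕ) + 1
        · exact hb _ hA (by omega) hn
        · have := hlev _ (hn (by omega))
          simp only at this
          omega
    · rintro ⟨v, hv, hv0⟩
      have := hlev v hv
      rw [hv0] at this
      simp at this

/-- An earlier block only makes the particle halt nearer the source, which is what the potential
needs. -/
lemma exists_haltsAt {B : Finset (Vertex k N)} {r : Walk k N} {i : Fin (k + 1)}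
    (h : NextOccupied B r i) : ∃ j ≤ i, HaltsAt B r j := by
  induction i using WellFoundedLT.induction with
  | ind i ih =>
    by_cases h' : ∃ i' < i, NextOccupied B r i'
    · obtain ⟨i', hi', hn⟩ := h'
      obtain ⟨j, hj, hh⟩ := ih i' hi' hn
      exact ⟨j, hj.trans hi'.le, hh⟩
    · exact ⟨i, le_rfl, h, fun i' hi' hn => h' ⟨i', hi', hn⟩⟩

/-! ### Expected time to reach the source. -/

/-- The expected time until a particle halts just above depth `b`, when `m` vertices at depth `a`
are occupied. -/
noncomputable def stage (k : ℕ) (N : ℕ → ℕ+) (a : ℕ) (m : ℝ) (b : ℕ) : ℝ :=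
  if b = a then width k N a / m else width k N b

open Classical in
/-- A bound for the expected time until the source is occupied. -/
noncomputable def potential (a : ℕ) (m : ℝ) (B : Finset (Vertex k N)) : ℝ :=
  ∑ b ∈ Finset.Icc a k, if ∀ v ∈ B, k + 1 - b ≤ (v.1 : ℕ) then stage k N a m b else 0

lemma stage_nonneg (a : ℕ) {m : ℝ} (hm : 0 < m) (b : ℕ) : 0 ≤ stage k N a m b := by
  have h1 := width_pos (k := k) (N := N) a
  have h2 := width_pos (k := k) (N := N) b
  unfold stage; split_ifs <;> positivity

lemma potential_nonneg (a : ℕ) {m : ℝ} (hm : 0 < m) (B : Finset (Vertex k N)) :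
    0 ≤ potential a m B :=
  Finset.sum_nonneg fun b _ => by
    split_ifs
    · exact stage_nonneg a hm b
    · exact le_rfl

lemma potential_le {a : ℕ} (ha : a ≤ k) {m : ℝ} (hm : 0 < m) (B : Finset (Vertex k N)) :
    potential a m B ≤ width k N a / m + ∑ b ∈ Finset.Ioc a k, width k N b := by
  have h : potential a m B ≤ ∑ b ∈ Finset.Icc a k, stage k N a m b :=
    Finset.sum_le_sum fun b _ => by
      split_ifs
      · exact le_rfl
      · exact stage_nonneg a hm b
  refine h.trans (le_of_eq ?_)
  rw [← Finset.Ioc_insert_left ha, Finset.sum_insert (by simp)]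
  congr 1
  · simp [stage]
  · refine Finset.sum_congr rfl fun b hb => ?_
    rw [Finset.mem_Ioc] at hb
    rw [stage, if_neg (by omega)]

/-- On average, the potential decreases by `1` in a step. -/
lemma integral_potential_step_le {a : ℕ} (ha : 1 ≤ a) (hak : a ≤ k) {m : ℝ} (hm : 0 < m)
    {B : Finset (Vertex k N)} (hB : m ≤ pop B a) (hs : ¬ SourceOccupied B) :
    ∫ r, potential a m (step B r) ∂walkLaw k N ≤ potential a m B - 1 := by
  classical
  have hpa : 0 < pop B a := hm.trans_le hB
  -- The frontier is the occupied level nearest the source, at depth b. Any walk that hits it halts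
  -- beyond depth b, which removes the stage b from the potential.
  obtain ⟨v, hv, hmin⟩ := B.exists_min_image (fun v => (v.1 : ℕ))
    (by obtain ⟨v, hv, -⟩ := (pop_pos_iff (by omega)).1 hpa; exact ⟨v, hv⟩)
  set i := (v.1 : ℕ) with hi
  have hik := v.1.2
  have hi0 : i ≠ 0 := fun h => hs ⟨v, hv, Fin.ext h⟩
  set b := k + 1 - i with hb
  have hab : a ≤ b := by
    obtain ⟨w, hw, hwa⟩ := (pop_pos_iff (by omega)).1 hpa
    have := hmin w hw
    omega
  have hbk : b ≤ k := by omega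
  have hib : k + 1 - b = i := by omega
  have hpb : 0 < pop B b := (pop_pos_iff (by omega)).2 ⟨v, hv, by omega⟩
  have hpt : ∀ r : Walk k N, potential a m (step B r) ≤
      potential a m B - stage k N a m b * if Hit B r i then 1 else 0 := by
    intro r
    have hmono : ∀ c, (if ∀ v ∈ step B r, k + 1 - c ≤ (v.1 : ℕ) then stage k N a m c else 0) ≤
        if ∀ v ∈ B, k + 1 - c ≤ (v.1 : ℕ) then stage k N a m c else 0 := by
      intro c
      by_cases h : ∀ v ∈ step B r, k + 1 - c ≤ (v.1 : ℕ)
      · rw [if_pos h, if_pos fun v hv => h v (subset_step _ _ hv)]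
      · rw [if_neg h]
        split_ifs
        · exact stage_nonneg a hm c
        · exact le_rfl
    have hmem : b ∈ Finset.Icc a k := Finset.mem_Icc.2 ⟨hab, hbk⟩
    split_ifs with hr
    · unfold potential
      rw [← Finset.add_sum_erase _ _ hmem, ← Finset.add_sum_erase _ _ hmem, if_neg, if_pos]
      · have := Finset.sum_le_sum fun c (_ : c ∈ (Finset.Icc a k).erase b) => hmono c
        linarith
      · exact fun w hw => by rw [hib]; exact hmin w hw
      · intro hall
        obtain ⟨j, hj, hjh⟩ := exists_haltsAt (B := B) (r := r) (i := ⟨i - 1, by omega⟩) (by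
          rw [nextOccupied_iff_hit]
          simpa [show i - 1 + 1 = i by omega] using hr)
        have hjm : (⟨j, r j⟩ : Vertex k N) ∈ step B r := by
          unfold step
          rw [if_neg hs]
          exact Finset.mem_union_right _ (by simp [hjh])
        have h1 := hall _ hjm
        have h2 := Fin.le_def.1 hj
        simp only at h1 h2
        omega
    · rw [mul_zero, sub_zero]
      exact Finset.sum_le_sum fun c _ => hmono c
  have hint := integral_mono (μ := walkLaw k N) .of_finite .of_finite hpt
  rw [integral_sub .of_finite .of_finite, integral_const_mul, integral_ite_walkLaw,
    walkLaw_real_hit] at hint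
  refine hint.trans ?_
  simp only [integral_const, probReal_univ, smul_eq_mul, one_mul]
  have hw : (cnt B i : ℝ) / size k N i = pop B b / width k N b := by
    rw [pop, width, hib]
  rw [hw]
  have hwb := width_pos (k := k) (N := N) b
  -- The stage is at least the reciprocal of the probability of hitting the frontier: at depth a
  -- there are at least m targets, further out at least one.
  have h1 : 1 ≤ stage k N a m b * (pop B b / width k N b) := by
    unfold stage
    split_ifs with hba
    · have hwa := width_pos (k := k) (N := N) a
      have e : width k N a / m * (pop B a / width k N a) = pop B a / m := by field_simp
      rwa [hba, e, one_le_div hm]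
    · rw [mul_div_cancel₀ _ hwb.ne']
      exact one_le_pop hpb
  linarith

/-- Once `m` vertices at depth `a` are occupied, the source is soon occupied. -/
lemma law_real_unfinished_le {a : ℕ} (ha : 1 ≤ a) (hak : a ≤ k) {m : ℝ} (hm : 0 < m)
    {t' t : ℕ} (ht : t' ≤ t) :
    ((t : ℝ) - t') * (law k N).real {ρ | m ≤ pop (occupied ρ t') a ∧
        ¬ SourceOccupied (occupied ρ t)} ≤
      width k N a / m + ∑ b ∈ Finset.Ioc a k, width k N b := by
  classical
  set G : Finset (Vertex k N) → ℝ := fun B => if m ≤ pop B a then 1 else 0 with hG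
  set p := (law k N).real {ρ | m ≤ pop (occupied ρ t') a ∧ ¬ SourceOccupied (occupied ρ t)}
    with hp
  have hG0 : ∀ B, 0 ≤ G B := fun B => by simp only [hG]; split_ifs <;> norm_num
  have hG1 : ∀ B, G B ≤ 1 := fun B => by simp only [hG]; split_ifs <;> norm_num
  have hX : ∀ s, t' ≤ s → ∀ ρ ρ' : ℕ → Walk k N, (∀ i < s, ρ i = ρ' i) →
      (occupied ρ t', occupied ρ s) = (occupied ρ' t', occupied ρ' s) := by
    intro s hs ρ ρ' h
    rw [occupied_congr s ρ ρ' h, occupied_congr t' ρ ρ' fun i hi => h i (by omega)]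
  have hI : ∀ s, t' ≤ s → ∀ f : Finset (Vertex k N) × Finset (Vertex k N) → ℝ,
      Integrable (fun ρ => f (occupied ρ t', occupied ρ s)) (law k N) := fun s hs f =>
    integrable_of_before fun ρ ρ' h => by rw [hX s hs ρ ρ' h]
  have hpint : p = ∫ ρ, (if m ≤ pop (occupied ρ t') a ∧ ¬ SourceOccupied (occupied ρ t) then
      (1 : ℝ) else 0) ∂law k N := by
    have hms : MeasurableSet {ρ : ℕ → Walk k N |
        m ≤ pop (occupied ρ t') a ∧ ¬ SourceOccupied (occupied ρ t)} :=
      measurable_of_before (s := t) (S := Prop)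
        (f := fun ρ => m ≤ pop (occupied ρ t') a ∧ ¬ SourceOccupied (occupied ρ t))
        (fun ρ ρ' h => by
          have := hX t ht ρ ρ' h
          rw [Prod.mk.injEq] at this
          rw [this.1, this.2]) |>.setOf
    rw [hp, ← integral_indicator_one hms]
    congr 1
    funext ρ
    simp [Set.indicator]
  -- The event at t' belongs to the past of step s, so it can multiply the potential before the next
  -- walk is averaged. The decrease is at least the probability of being unfinished at the final
  -- time t, since that implies being unfinished at s; hence the same p at every step.
  have hstep : ∀ s, t' ≤ s → s < t →
      ∫ ρ, G (occupied ρ t') * potential a m (occupied ρ (s + 1)) ∂law k N ≤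
        ∫ ρ, G (occupied ρ t') * potential a m (occupied ρ s) ∂law k N - p := by
    intro s hs hst
    have h1 := integral_before_next (hX s hs) fun B r => G B.1 * potential a m (step B.2 r)
    simp only at h1
    have e : ∀ ρ : ℕ → Walk k N, occupied ρ (s + 1) = step (occupied ρ s) (ρ s) := fun ρ => rfl
    simp only [e]
    rw [h1, hpint, ← integral_sub (hI s hs fun B => G B.1 * potential a m B.2)
      (hI t ht fun B => if m ≤ pop B.1 a ∧ ¬ SourceOccupied B.2 then 1 else 0)]
    refine integral_mono
      (hI s hs fun B => ∫ r, G B.1 * potential a m (step B.2 r) ∂walkLaw k N)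
      ((hI s hs fun B => G B.1 * potential a m B.2).sub
      (hI t ht fun B => if m ≤ pop B.1 a ∧ ¬ SourceOccupied B.2 then 1 else 0)) fun ρ => ?_
    simp only
    by_cases hg : m ≤ pop (occupied ρ t') a
    · have hg' : m ≤ pop (occupied ρ s) a := hg.trans (pop_mono (occupied_mono ρ hs) a)
      simp only [hG, if_pos hg, one_mul]
      by_cases hso : SourceOccupied (occupied ρ s)
      · have hso' : SourceOccupied (occupied ρ t) := by
          obtain ⟨v, hv, h0⟩ := hso
          exact ⟨v, occupied_mono ρ hst.le hv, h0⟩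
        rw [if_neg fun h => h.2 hso']
        have : ∀ r, step (occupied ρ s) r = occupied ρ s := fun r => if_pos hso
        simp [this]
      · have h2 := integral_potential_step_le ha hak hm hg' hso
        split_ifs <;> linarith
    · rw [if_neg fun h => hg h.1]
      simp [hG, if_neg hg]
  have hsum : ∀ d, t' + d ≤ t → d * p ≤
      ∫ ρ, G (occupied ρ t') * potential a m (occupied ρ t') ∂law k N -
        ∫ ρ, G (occupied ρ t') * potential a m (occupied ρ (t' + d)) ∂law k N := by
    intro d
    induction d with
    | zero => simp
    | succ d ih =>
      intro hd
      have h1 := ih (by omega)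
      have h2 := hstep (t' + d) (by omega) (by omega)
      rw [← add_assoc]
      push_cast
      linarith
  have h1 := hsum (t - t') (by omega)
  rw [Nat.cast_sub ht] at h1
  refine h1.trans ((sub_le_self _ (integral_nonneg fun ρ =>
    mul_nonneg (hG0 _) (potential_nonneg a hm _))).trans ?_)
  have h2 := integral_mono (hI t' le_rfl fun B => G B.1 * potential a m B.2)
    (integrable_const (width k N a / m + ∑ b ∈ Finset.Ioc a k, width k N b))
    fun ρ => (mul_le_of_le_one_left (potential_nonneg a hm _) (hG1 _)).trans
      (potential_le hak hm (occupied ρ t'))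
  simpa using h2

/-! ### Concentration and completion within a regime. -/

/-- The expected numbers decrease up to depth `H`, little is lost by blocking at depths up to `H`,
and the larger depths fill up fast. -/
structure Regime (n : ℕ → ℝ) (k H : ℕ) (t c : ℝ) : Prop where
  one_le : 1 ≤ H
  le : H ≤ k
  decreasing : Decreasing n H t
  loss : H * (4 ^ H * ∑ b ∈ Finset.Icc 1 H, nu n b t / n b) ≤ c
  fill : H * ∑ b ∈ Finset.Ioc H k, n b ≤ c * t

/-- Bernoulli's inequality: moving back by r costs a relative error of at most a r / t. -/
lemma nu_sub_ge {n : ℕ → ℝ} (hn : ∀ a, 0 < n a) (a : ℕ) {t r : ℝ} (ht : 0 < t) (hr : r ≤ t) :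
    (1 - a * (r / t)) * nu n a t ≤ nu n a (t - r) := by
  have hw := weight_pos hn a
  have h1 : r / t ≤ 1 := by rwa [div_le_one ht]
  have h2 := one_add_mul_le_pow (a := -(r / t)) (by linarith) a
  have h3 : (1 + -(r / t)) ^ a * t ^ a = (t - r) ^ a := by
    rw [← mul_pow]; congr 1; field_simp; ring
  have h4 := mul_le_mul_of_nonneg_right h2 (show 0 ≤ t ^ a by positivity)
  rw [h3] at h4
  unfold nu
  rw [← mul_div_assoc]
  gcongr
  linarith

lemma half_le_floor {x : ℝ} (hx : 1 ≤ x) : x / 2 ≤ (⌊x⌋₊ : ℝ) := by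
  have h1 := Nat.lt_floor_add_one x
  have h2 : (1 : ℝ) ≤ ⌊x⌋₊ := by exact_mod_cast (Nat.one_le_floor_iff x).2 hx
  linarith

/-- The three errors of `law_real_abs_sub_nu_ge_le` in terms of c alone: 32 c from the variance, 4 c
from blocking and 4 c from the binomial coefficient. -/
lemma law_real_deviation_le {A H a s t : ℕ} {c δ : ℝ} (hA : k + 1 - H ≤ A)
    (hreg : Regime (width k N) k H t c) (ha : a ≤ H) (hs : 0 < s) (hst : s ≤ t)
    (hts : (t : ℝ) ≤ 2 * s) (hc : 0 < c) (hc1 : c ≤ 1) (hδ : 0 < δ)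
    (hat : (a : ℝ) ^ 2 ≤ c * t) (hM : ∀ g, 1 ≤ g → g ≤ a → 1 / c ≤ nu (width k N) g t)
    (ha1 : 1 ≤ a) (hnu : nu (width k N) a t ≤ 2 * nu (width k N) a s) :
    (law k N).real {ρ | δ * nu (width k N) a s ≤
        |pop (relaxed A ρ s) a - nu (width k N) a s|} ≤ 40 * c / δ ^ 2 := by
  have hn : ∀ a, 0 < width k N a := fun a => width_pos a
  have hs' : (0 : ℝ) < s := by exact_mod_cast hs
  have hc' : 1 ≤ 1 / c := by rw [one_le_div hc]; exact hc1
  have ht' : (0 : ℝ) < t := hs'.trans_le (by exact_mod_cast hst)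
  refine (law_real_abs_sub_nu_ge_le hA hreg.le ha hs hst hreg.decreasing ?_ hδ).trans ?_
  · intro g hg
    rcases Nat.eq_zero_or_pos g with rfl | hg0
    · rw [nu_zero]
    · exact hc'.trans (hM g hg0 hg.le)
  · gcongr
    have h1 : 16 / nu (width k N) a s ≤ 32 * c := by
      have h := hM a ha1 le_rfl
      rw [div_le_iff₀ (nu_pos hn a hs')]
      rw [div_le_iff₀ hc] at h
      nlinarith
    have h2 : (a : ℝ) * (4 ^ H * ∑ b ∈ Finset.Icc 1 H, nu (width k N) b t / width k N b) ≤ c := by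
      refine le_trans (mul_le_mul_of_nonneg_right (by exact_mod_cast ha) ?_) hreg.loss
      exact mul_nonneg (by positivity) (Finset.sum_nonneg fun b _ =>
        div_nonneg (nu_nonneg hn b ht'.le) (hn b).le)
    have h3 : 2 * (a : ℝ) ^ 2 / s ≤ 4 * c := by
      rw [div_le_iff₀ hs']
      nlinarith
    linarith

/-- A particle that halts above depth `H` is soon followed by one that occupies the source. -/
lemma law_real_deep_unfinished_le {H t' t : ℕ} (hH : H ≤ k) (ht : t' ≤ t) :
    ((t : ℝ) - t') * (law k N).real {ρ | 0 < pop (occupied ρ t') (H + 1) ∧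
        ¬ SourceOccupied (occupied ρ t)} ≤ ∑ b ∈ Finset.Ioc H k, width k N b := by
  have ht' : (0 : ℝ) ≤ t - t' := by rw [sub_nonneg]; exact_mod_cast ht
  rcases hH.lt_or_eq with hlt | rfl
  · have h := law_real_unfinished_le (N := N) (a := H + 1) (by omega) hlt one_pos ht
    rw [div_one, ← Finset.sum_insert (by simp), Finset.Ioc_insert_left hlt] at h
    have e : Finset.Icc (H + 1) k = Finset.Ioc H k := by ext; simp
    rw [e] at h
    refine le_trans (mul_le_mul_of_nonneg_left (measureReal_mono fun ρ hρ => ?_) ht') h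
    exact ⟨one_le_pop hρ.1, hρ.2⟩
  · have : {ρ : ℕ → Walk H N | 0 < pop (occupied ρ t') (H + 1) ∧
        ¬ SourceOccupied (occupied ρ t)} = ∅ := by
      ext ρ
      simp only [Set.mem_ofPred_eq, Set.mem_empty_iff_false, iff_false, not_and, not_not]
      intro h
      obtain ⟨v, hv, h0⟩ := (pop_pos_iff (by omega)).1 h
      exact ⟨v, occupied_mono ρ ht hv, Fin.ext (by simpa using h0)⟩
    rw [this]
    simp

/-- At depths up to `H`, the process is concentrated as long as it runs. -/
theorem law_real_bad_le {H a t : ℕ} {c ε : ℝ} (hreg : Regime (width k N) k H t c)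
    (ha1 : 1 ≤ a) (ha : a ≤ H) (hε : 0 < ε) (hε1 : ε ≤ 1) (hc : 0 < c) (hcε : c ≤ ε / 2)
    (hat : (a : ℝ) ^ 2 ≤ c * t) (hM : ∀ g, 1 ≤ g → g ≤ a → 1 / c ≤ nu (width k N) g t) :
    (law k N).real {ρ | ¬ SourceOccupied (occupied ρ t) ∧
      ε * nu (width k N) a t < |pop (occupied ρ t) a - nu (width k N) a t|} ≤ 250 * c / ε ^ 2 := by
  have hn : ∀ a, 0 < width k N a := fun a => width_pos a
  have ha0 : (1 : ℝ) ≤ a := by exact_mod_cast ha1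
  have haH : (a : ℝ) ≤ H := by exact_mod_cast ha
  have hat1 : (a : ℝ) ≤ c * t := by nlinarith
  have ht0 : (0 : ℝ) < t := by
    by_contra! h
    nlinarith
  have ht0' : 0 < t := by exact_mod_cast ht0
  -- The delay x makes a x / t = ε / 2, so ν_a changes by a factor of at least 1 - ε / 2, yet is
  -- long enough for the depths beyond H to fill up.
  set x : ℝ := ε * t / (2 * a) with hx
  have hx1 : 1 ≤ x := by
    rw [hx, one_le_div (by positivity)]
    nlinarith
  have hxt : x ≤ t / 2 := by
    rw [hx, div_le_div_iff₀ (by positivity) (by norm_num)]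
    nlinarith [mul_le_mul hε1 ha0 zero_le_one zero_le_one, mul_pos hε ht0,
      mul_le_mul_of_nonneg_right hε1 ht0.le, mul_le_mul_of_nonneg_right ha0 ht0.le]
  have hr1 := half_le_floor hx1
  have hr2 := Nat.floor_le (zero_le_one.trans hx1)
  set r := ⌊x⌋₊ with hr
  have hrt : (r : ℝ) ≤ t / 2 := hr2.trans hxt
  have hrt' : r ≤ t := by
    have : (r : ℝ) ≤ t := by linarith
    exact_mod_cast this
  set t' := t - r with ht'
  have ht'r : (t' : ℝ) = t - r := by rw [ht', Nat.cast_sub hrt']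
  have ht'0 : 0 < t' := by
    have : (0 : ℝ) < t' := by rw [ht'r]; linarith
    exact_mod_cast this
  have hnu' : (1 - ε / 2) * nu (width k N) a t ≤ nu (width k N) a t' := by
    rw [ht'r]
    refine le_trans ?_ (nu_sub_ge hn a ht0 (by linarith))
    have hN := nu_pos hn a ht0
    have : (a : ℝ) * (r / t) ≤ ε / 2 := by
      rw [← mul_div_assoc, div_le_iff₀ ht0]
      have : (a : ℝ) * x = ε * t / 2 := by rw [hx]; field_simp
      nlinarith
    gcongr
  have hN := nu_pos hn a ht0
  have hc1 : c ≤ 1 := by linarith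
  have h1 := law_real_deviation_le (N := N) (A := k + 1) (s := t) (δ := ε) (by omega) hreg ha ht0'
    le_rfl (by linarith) hc hc1 hε hat hM ha1 (by linarith)
  have h3 := law_real_deviation_le (N := N) (A := k + 1 - H) (s := t') (δ := ε / 2) le_rfl hreg ha
    ht'0 (Nat.sub_le _ _) (by rw [ht'r]; linarith) hc hc1 (by positivity) hat hM ha1
    (by nlinarith)
  have h2 := law_real_deep_unfinished_le (k := k) (N := N) (H := H) hreg.le
    (show t' ≤ t from Nat.sub_le _ _)
  set E1 := {ρ : ℕ → Walk k N | ε * nu (width k N) a t ≤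
    |pop (relaxed (k + 1) ρ t) a - nu (width k N) a t|}
  set E2 := {ρ : ℕ → Walk k N | 0 < pop (occupied ρ t') (H + 1) ∧
        ¬ SourceOccupied (occupied ρ t)}
  set E3 := {ρ : ℕ → Walk k N | ε / 2 * nu (width k N) a t' ≤
    |pop (relaxed (k + 1 - H) ρ t') a - nu (width k N) a t'|}
  -- Outside E2 an unfinished run has depth H + 1 empty at t', so the true and the relaxed process
  -- agree there. The lower bound is then (1 - ε/2)² ν ≥ (1 - ε) ν.
  have hsub : {ρ : ℕ → Walk k N | ¬ SourceOccupied (occupied ρ t) ∧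
      ε * nu (width k N) a t < |pop (occupied ρ t) a - nu (width k N) a t|} ⊆ E1 ∪ (E2 ∪ E3) := by
    rintro ρ ⟨hs, hbad⟩
    by_contra hcon
    simp only [Set.mem_union, not_or] at hcon
    obtain ⟨c1, c2, c3⟩ := hcon
    have c1' : |pop (relaxed (k + 1) ρ t) a - nu (width k N) a t| < ε * nu (width k N) a t :=
      not_le.1 c1
    have c3' : |pop (relaxed (k + 1 - H) ρ t') a - nu (width k N) a t'| <
      ε / 2 * nu (width k N) a t' := not_le.1 c3
    replace c1' := (abs_lt.1 c1').2
    replace c3' := (abs_lt.1 c3').1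
    have hz : pop (occupied ρ t') (H + 1) = 0 := by
      refine le_antisymm ?_ (pop_nonneg _ _)
      by_contra! h
      exact c2 ⟨h, hs⟩
    rw [← occupied_eq_relaxed hreg.le hz] at c3'
    have hup := pop_mono (occupied_subset_relaxed ρ t) a
    have hlo := pop_mono (occupied_mono ρ (show t' ≤ t from Nat.sub_le _ _)) a
    refine absurd hbad (not_lt.2 (abs_le.2 ⟨?_, by linarith⟩))
    have : (1 - ε / 2) * ((1 - ε / 2) * nu (width k N) a t) ≤
        (1 - ε / 2) * nu (width k N) a t' :=
      mul_le_mul_of_nonneg_left hnu' (by linarith)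
    nlinarith [mul_nonneg (sq_nonneg ε) hN.le]
  have h2' : (law k N).real E2 ≤ 4 * c / ε ^ 2 := by
    have hS : (r : ℝ) * (law k N).real E2 ≤ ∑ b ∈ Finset.Ioc H k, width k N b := by
      have : (t : ℝ) - t' = r := by rw [ht'r]; ring
      rwa [this] at h2
    have hS0 : 0 ≤ ∑ b ∈ Finset.Ioc H k, width k N b :=
      Finset.sum_nonneg fun b _ => (hn b).le
    have hp : 0 ≤ (law k N).real E2 := measureReal_nonneg
    have hf := hreg.fill
    have h5 : a * (∑ b ∈ Finset.Ioc H k, width k N b) ≤ c * t :=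
      (mul_le_mul_of_nonneg_right haH hS0).trans hf
    have h6 : ε * t / 4 ≤ a * r := by
      have : (a : ℝ) * x = ε * t / 2 := by rw [hx]; field_simp
      nlinarith
    have h7 : ε * t / 4 * (law k N).real E2 ≤ c * t := by
      calc ε * t / 4 * (law k N).real E2 ≤ a * r * (law k N).real E2 := by gcongr
        _ = a * (r * (law k N).real E2) := by ring
        _ ≤ a * ∑ b ∈ Finset.Ioc H k, width k N b := by gcongr
        _ ≤ c * t := h5
    have h8 : ε * (law k N).real E2 ≤ 4 * c := by
      by_contra! h
      have := mul_lt_mul_of_pos_right h ht0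
      linarith
    rw [le_div_iff₀ (by positivity)]
    calc (law k N).real E2 * ε ^ 2 = ε * (ε * (law k N).real E2) := by ring
      _ ≤ 1 * (ε * (law k N).real E2) := by gcongr
      _ ≤ 4 * c := by linarith
  have h9 := (measureReal_mono (μ := law k N) hsub).trans
    ((measureReal_union_le _ _).trans (add_le_add_right (measureReal_union_le _ _) _))
  have e3 : 40 * c / (ε / 2) ^ 2 = 160 * c / ε ^ 2 := by field_simp; norm_num
  rw [e3] at h3
  -- The three events cost 40, 4 and 160; the remaining 46 is slack.
  have e : 250 * c / ε ^ 2 = 40 * c / ε ^ 2 + (4 * c / ε ^ 2 + 160 * c / ε ^ 2) +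
    46 * c / ε ^ 2 := by ring
  have : 0 ≤ 46 * c / ε ^ 2 := by positivity
  linarith

/-- If the expected number at depth `H + 1` is large as well, then the process has stopped. -/
theorem law_real_unfinished_le_of_regime {H t : ℕ} {c : ℝ} (hreg : Regime (width k N) k H t c)
    (hc : 0 < c) (hc1 : c ≤ 1 / 2) (hat : ((H : ℝ) + 1) ^ 2 ≤ c * t)
    (hM : ∀ g, 1 ≤ g → g ≤ H + 1 → 1 / c ≤ nu (width k N) g t) :
    (law k N).real {ρ | ¬ SourceOccupied (occupied ρ t)} ≤ 200 * c := by
  have hn : ∀ a, 0 < width k N a := fun a => width_pos a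
  have hH1 : (1 : ℝ) ≤ H := by exact_mod_cast hreg.one_le
  have hat1 : (H : ℝ) + 1 ≤ c * t := by nlinarith
  have ht0 : (0 : ℝ) < t := by
    by_contra! h
    nlinarith
  set x : ℝ := t / (2 * (H + 1)) with hx
  have hxH : (H + 1) * x = t / 2 := by rw [hx]; field_simp
  have hx1 : 1 ≤ x := by
    rw [hx, one_le_div (by positivity)]
    nlinarith
  have hxt : x ≤ t / 2 := by nlinarith
  have hr1 := half_le_floor hx1
  have hr2 := Nat.floor_le (zero_le_one.trans hx1)
  set r := ⌊x⌋₊ with hr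
  have hrt : (r : ℝ) ≤ t / 2 := hr2.trans hxt
  have hrt' : r ≤ t := by
    have : (r : ℝ) ≤ t := by linarith
    exact_mod_cast this
  set t' := t - r with ht'
  have ht'r : (t' : ℝ) = t - r := by rw [ht', Nat.cast_sub hrt']
  have ht'0' : (0 : ℝ) < t' := by rw [ht'r]; linarith
  have ht'0 : 0 < t' := by exact_mod_cast ht'0'
  have hN := nu_pos hn H ht0
  have hN' := nu_pos hn H ht'0'
  have hnu' : nu (width k N) H t ≤ 2 * nu (width k N) H t' := by
    have h := nu_sub_ge hn H ht0 (show (r : ℝ) ≤ t by linarith)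
    rw [← ht'r] at h
    have : (H : ℝ) * (r / t) ≤ 1 / 2 := by
      rw [← mul_div_assoc, div_le_iff₀ ht0]
      nlinarith
    nlinarith
  have h3 := law_real_deviation_le (N := N) (A := k + 1 - H) (s := t') (δ := 1 / 2) le_rfl hreg
    le_rfl ht'0 (Nat.sub_le _ _) (by rw [ht'r]; linarith) hc (by linarith) (by norm_num)
    (by nlinarith) (fun g h1 h2 => hM g h1 (by omega)) hreg.one_le hnu'
  have h2 := law_real_deep_unfinished_le (k := k) (N := N) (H := H) hreg.le
    (show t' ≤ t from Nat.sub_le _ _)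
  have h4 := law_real_unfinished_le (k := k) (N := N) (a := H) hreg.one_le hreg.le
    (m := nu (width k N) H t' / 2) (by positivity) (show t' ≤ t from Nat.sub_le _ _)
  have htr : (t : ℝ) - t' = r := by rw [ht'r]; ring
  rw [htr] at h2 h4
  set E2 := {ρ : ℕ → Walk k N | 0 < pop (occupied ρ t') (H + 1) ∧
        ¬ SourceOccupied (occupied ρ t)}
  set E3 := {ρ : ℕ → Walk k N | 1 / 2 * nu (width k N) H t' ≤
    |pop (relaxed (k + 1 - H) ρ t') H - nu (width k N) H t'|}
  set E4 := {ρ : ℕ → Walk k N | nu (width k N) H t' / 2 ≤ pop (occupied ρ t') H ∧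
        ¬ SourceOccupied (occupied ρ t)}
  set S := ∑ b ∈ Finset.Ioc H k, width k N b with hS
  -- An unfinished run at t either had reached depth H + 1 by t', or deviated at depth H, or had at
  -- least half of the expected number at depth H and still failed to finish.
  have hsub : {ρ : ℕ → Walk k N | ¬ SourceOccupied (occupied ρ t)} ⊆ E2 ∪ (E3 ∪ E4) := by
    intro ρ hs
    by_contra hcon
    simp only [Set.mem_union, not_or] at hcon
    obtain ⟨c2, c3, c4⟩ := hcon
    have c3' : |pop (relaxed (k + 1 - H) ρ t') H - nu (width k N) H t'| <
      1 / 2 * nu (width k N) H t' := not_le.1 c3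
    replace c3' := (abs_lt.1 c3').1
    have hz : pop (occupied ρ t') (H + 1) = 0 := by
      refine le_antisymm ?_ (pop_nonneg _ _)
      by_contra! h
      exact c2 ⟨h, hs⟩
    rw [← occupied_eq_relaxed hreg.le hz] at c3'
    exact c4 ⟨by linarith, hs⟩
  have hS0 : 0 ≤ S := Finset.sum_nonneg fun b _ => (hn b).le
  have hrH : t / 4 ≤ (H + 1) * (r : ℝ) := by nlinarith
  have hSH : (H + 1) * S ≤ 2 * c * t := by
    have hf := hreg.fill
    nlinarith
  have hcancel : ∀ {p y : ℝ}, 0 ≤ p → r * p ≤ y → t / 4 * p ≤ (H + 1) * y := by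
    intro p y hp h
    calc t / 4 * p ≤ (H + 1) * r * p := by gcongr
      _ = (H + 1) * (r * p) := by ring
      _ ≤ (H + 1) * y := by gcongr
  have h2' : (law k N).real E2 ≤ 8 * c := by
    have := hcancel measureReal_nonneg h2
    by_contra! h
    have := mul_lt_mul_of_pos_right h ht0
    linarith
  -- From ν_{H+1} = ν_H t / ((H + 1) n_H) ≥ 1/c, the waiting time n_H / ν_H for leaving depth H is
  -- at most c t / (H + 1), small against the delay.
  have h4' : (law k N).real E4 ≤ 24 * c := by
    have h5 := hcancel measureReal_nonneg h4
    have h6 := hM (H + 1) (by omega) le_rfl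
    rw [nu_succ hn, div_le_iff₀ hc] at h6
    have hnH := hn H
    have h7 : (H + 1) * (width k N H / (nu (width k N) H t' / 2)) ≤ 4 * c * t := by
      have e : (H + 1) * (width k N H / (nu (width k N) H t' / 2)) =
          2 * ((H + 1) * width k N H) / nu (width k N) H t' := by field_simp
      rw [e, div_le_iff₀ hN']
      have e2 : nu (width k N) H t * (t / ((H + 1) * width k N H)) * c =
          nu (width k N) H t * t * c / ((H + 1) * width k N H) := by ring
      rw [e2, le_div_iff₀ (by positivity)] at h6
      have := mul_le_mul_of_nonneg_right hnu' (show 0 ≤ t * c by positivity)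
      linarith
    by_contra! h
    have := mul_lt_mul_of_pos_right h ht0
    rw [mul_add] at h5
    linarith
  have h9 := (measureReal_mono (μ := law k N) hsub).trans
    ((measureReal_union_le _ _).trans (add_le_add_right (measureReal_union_le _ _) _))
  norm_num at h3
  linarith

lemma mu_eq_nu (j t : ℕ) : mu k N j t = nu (width k N) (j + 1) t := by
  unfold mu nu weight
  rw [Finset.prod_range_succ']
  have h0 : width k N 0 = 1 := by simp [width, size]
  rw [h0, mul_one]
  congr 2
  refine Finset.prod_congr rfl fun i _ => ?_
  rw [width, size, if_pos (by omega), Nat.add_sub_add_right]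

lemma occupancy_eq_pop (ρ : ℕ → Walk k N) (j t : ℕ) :
    (occupancy ρ (k - j) t : ℝ) = pop (occupied ρ t) (j + 1) := by
  rw [occupancy, pop, cnt, if_pos (by omega), Nat.add_sub_add_right]

lemma not_sourceOccupied_of_lt_finishTime {ρ : ℕ → Walk k N} {t : ℕ}
    (h : (t : ℕ∞) < finishTime ρ) : ¬ SourceOccupied (occupied ρ t) := fun hs =>
  absurd (iInf_le (fun t : {t : ℕ // SourceOccupied (occupied ρ t)} => ((t : ℕ) : ℕ∞)) ⟨t, hs⟩)
    (not_le.2 h)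

/-! ### From regular layer sizes to the asymptotic statement. -/

/-- A regime is available at every time at which some expected number is not large. -/
structure Regular (k : ℕ) (n : ℕ → ℝ) (c : ℝ) : Prop where
  large : (((k : ℝ) + 1) ^ 2) ^ 2 ≤ c ^ 2 * n 1
  exists_regime : ∀ t : ℝ, 0 < t → (∃ g, 1 ≤ g ∧ g ≤ k + 1 ∧ nu n g t ≤ 2 / c) →
    ∃ H, Regime n k H t c

lemma width_zero : width k N 0 = 1 := by simp [width, size]

lemma nu_one {n : ℕ → ℝ} (h0 : n 0 = 1) (t : ℝ) : nu n 1 t = t := by simp [nu, weight, h0]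

lemma nu_two {n : ℕ → ℝ} (h0 : n 0 = 1) (t : ℝ) : nu n 2 t = t ^ 2 / (2 * n 1) := by
  simp [nu, weight, h0, Finset.prod_range_succ]

/-- Once ν_2 ≥ 1, t² is at least 2 n_1, so the growth of n_1 makes k² negligible against t. -/
lemma Regular.sq_le {c t : ℝ} (h : Regular k (width k N) c) (hc : 0 < c) (hc1 : c ≤ 1)
    (ht : 0 < t) (h2 : 1 / c ≤ nu (width k N) 2 t) : ((k : ℝ) + 1) ^ 2 ≤ c * t := by
  rw [nu_two width_zero] at h2
  have h1 := width_pos (k := k) (N := N) 1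
  have h3 : 1 ≤ t ^ 2 / (2 * width k N 1) := le_trans (by rwa [one_le_div hc]) h2
  rw [one_le_div (by positivity)] at h3
  refine le_of_sq_le_sq ?_ (by positivity)
  refine h.large.trans ?_
  rw [mul_pow]
  gcongr
  linarith

/-- The quantitative form of the theorem, for a single graph. -/
theorem Regular.law_real_bad_le {c ε : ℝ} (h : Regular k (width k N) c) (hc : 0 < c)
    (hε : 0 < ε) (hε1 : ε ≤ 1) (hcε : c ≤ ε / 2) {j t : ℕ} (hj : j ≤ k)
    (hmu : ∀ l ≤ j, 1 / c ≤ mu k N l t) :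
    (law k N).real {ρ | ¬ SourceOccupied (occupied ρ t) ∧
      ε * nu (width k N) (j + 1) t < |pop (occupied ρ t) (j + 1) - nu (width k N) (j + 1) t|} ≤
      250 * c / ε ^ 2 := by
  have hn : ∀ a, 0 < width k N a := fun a => width_pos a
  have hc1 : c ≤ 1 / 2 := by linarith
  have hM : ∀ g, 1 ≤ g → g ≤ j + 1 → 1 / c ≤ nu (width k N) g t := by
    intro g h1 h2
    have := hmu (g - 1) (by omega)
    rwa [mu_eq_nu, show g - 1 + 1 = g by omega] at this
  have ht1 := hM 1 le_rfl (by omega)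
  rw [nu_one width_zero] at ht1
  have ht0 : (0 : ℝ) < t := lt_of_lt_of_le (by positivity) ht1
  have hbig : 200 * c ≤ 250 * c / ε ^ 2 := by
    rw [le_div_iff₀ (by positivity)]
    have : ε ^ 2 ≤ 1 := by nlinarith
    nlinarith
  by_cases hex : ∃ g, 1 ≤ g ∧ g ≤ k + 1 ∧ nu (width k N) g t ≤ 2 / c
  · obtain ⟨H, hreg⟩ := h.exists_regime t ht0 hex
    -- If j + 1 exceeds H, then ν_{H+1} is among the quantities assumed large, so the process has
    -- already stopped.
    rcases le_or_gt (j + 1) H with hjH | hjH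
    · refine LayersDLA.law_real_bad_le hreg (by omega) hjH hε hε1 hc hcε ?_ hM
      rcases Nat.eq_zero_or_pos j with rfl | hj0
      · rw [div_le_iff₀ hc] at ht1
        norm_num
        linarith
      · refine le_trans ?_ (h.sq_le hc (by linarith) ht0 (hM 2 (by omega) (by omega)))
        have : (j : ℝ) ≤ k := by exact_mod_cast hj
        push_cast
        gcongr
    · have hH := hreg.one_le
      refine le_trans (le_trans (measureReal_mono fun ρ hρ => hρ.1)
        (law_real_unfinished_le_of_regime hreg hc hc1 ?_
          fun g h1 h2 => hM g h1 (by omega))) hbig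
      refine le_trans ?_ (h.sq_le hc (by linarith) ht0 (hM 2 (by omega) (by omega)))
      have : (H : ℝ) ≤ k := by exact_mod_cast hreg.le
      gcongr
  · push Not at hex
    classical
    have hP : ∃ u : ℕ, ∀ g, 1 ≤ g → g ≤ k + 1 → 1 / c ≤ nu (width k N) g u := by
      refine ⟨t, fun g h1 h2 => le_trans ?_ (hex g h1 h2).le⟩
      gcongr
      norm_num
    -- When all expected numbers exceed 2/c, no regime is guaranteed at t. At the first time u with
    -- all of them at least 1/c there is one, and finishing by u implies finishing by t.
    set u := Nat.find hP with hu
    have hPu := Nat.find_spec hP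
    rw [← hu] at hPu
    have hut : u ≤ t := Nat.find_min' hP fun g h1 h2 => by
      refine le_trans ?_ (hex g h1 h2).le
      gcongr
      norm_num
    have hu1 := hPu 1 le_rfl (by omega)
    rw [nu_one width_zero] at hu1
    have hu0 : (0 : ℝ) < u := lt_of_lt_of_le (by positivity) hu1
    have hu0' : 0 < u := by exact_mod_cast hu0
    have hsq : ((k : ℝ) + 1) ^ 2 ≤ c * u := by
      rcases Nat.eq_zero_or_pos k with rfl | hk
      · rw [div_le_iff₀ hc] at hu1
        norm_num
        linarith
      · exact h.sq_le hc (by linarith) hu0 (hPu 2 (by omega) (by omega))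
    have hmin := Nat.find_min hP (m := u - 1) (by omega)
    push Not at hmin
    obtain ⟨g, hg1, hgk, hg⟩ := hmin
    -- Some ν_g was below 1/c at u - 1, and one step at most doubles it because g ≤ u / 2.
    have hgu : nu (width k N) g u ≤ 2 / c := by
      have h1 := nu_sub_ge hn g hu0 (r := 1) (by exact_mod_cast hu0')
      have hcast : ((u - 1 : ℕ) : ℝ) = u - 1 := by
        rw [Nat.cast_sub hu0', Nat.cast_one]
      rw [hcast] at hg
      have h2 : (g : ℝ) * (1 / u) ≤ 1 / 2 := by
        rw [mul_one_div, div_le_iff₀ hu0]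
        have : (g : ℝ) ≤ k + 1 := by exact_mod_cast hgk
        nlinarith
      have h3 := mul_le_mul_of_nonneg_right (show 1 / 2 ≤ 1 - (g : ℝ) * (1 / u) by linarith)
        (nu_nonneg hn g hu0.le)
      have e : 2 / c = 2 * (1 / c) := by ring
      rw [e]
      linarith
    obtain ⟨H, hreg⟩ := h.exists_regime u hu0 ⟨g, hg1, hgk, hgu⟩
    refine le_trans (le_trans (measureReal_mono fun ρ hρ => ?_)
      (law_real_unfinished_le_of_regime hreg hc hc1 ?_
        fun g h1 h2 => hPu g h1 (by have := hreg.le; omega))) hbig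
    · rintro ⟨v, hv, hv0⟩
      exact hρ.1 ⟨v, occupied_mono ρ hut hv, hv0⟩
    · refine le_trans ?_ hsq
      have : (H : ℝ) ≤ k := by exact_mod_cast hreg.le
      gcongr

theorem occupancyAsymptotics_of_regular {k : ℕ → ℕ} {N : ℕ → ℕ → ℕ+}
    (h : ∀ c : ℝ, 0 < c → c ≤ 1 → ∀ᶠ m in atTop, Regular (k m) (width (k m) (N m)) c) :
    OccupancyAsymptotics k N := by
  intro j t hj hmu ε₀ hε₀
  rw [tendsto_order]
  refine ⟨fun a ha => ?_, fun a ha => Eventually.of_forall fun m => prob_le_one.trans_lt ha⟩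
  have ha' : a.toReal < 1 := by
    rw [← ENNReal.toReal_one]
    exact (ENNReal.toReal_lt_toReal (ha.trans_le le_top).ne ENNReal.one_ne_top).2 ha
  set ε := min ε₀ 1 with hε_def
  have hε : 0 < ε := lt_min hε₀ one_pos
  have hε1 : ε ≤ 1 := min_le_right _ _
  set η := 1 - a.toReal with hη
  have hη0 : 0 < η := by linarith
  -- This makes 250 c / ε² at most η / 2, below the allowed failure probability η.
  set c := min (ε / 2) (ε ^ 2 * η / 500) with hc_def
  have hc : 0 < c := lt_min (by positivity) (by positivity)
  have hc1 : c ≤ ε / 2 := min_le_left _ _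
  have hc2 : 250 * c / ε ^ 2 < η := by
    rw [div_lt_iff₀ (by positivity)]
    have : c ≤ ε ^ 2 * η / 500 := min_le_right _ _
    have : 0 < ε ^ 2 * η := by positivity
    linarith
  filter_upwards [h c hc (by linarith), hmu (1 / c)] with m hreg hm
  have hbad := hreg.law_real_bad_le hc hε hε1 hc1 (hj m) hm
  set good := {ρ : ℕ → Walk (k m) (N m) | (t m : ℕ∞) < finishTime ρ →
    |(occupancy ρ (k m - j m) (t m) : ℝ) / mu (k m) (N m) (j m) (t m) - 1| ≤ ε₀} with hgood
  set bad := {ρ : ℕ → Walk (k m) (N m) | ¬ SourceOccupied (occupied ρ (t m)) ∧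
      ε * nu (width (k m) (N m)) (j m + 1) (t m) <
        |pop (occupied ρ (t m)) (j m + 1) - nu (width (k m) (N m)) (j m + 1) (t m)|} with hbad_def
  have hsub : goodᶜ ⊆ bad := by
    intro ρ hρ
    have hρ' : ¬ ((t m : ℕ∞) < finishTime ρ →
      |(occupancy ρ (k m - j m) (t m) : ℝ) / mu (k m) (N m) (j m) (t m) - 1| ≤ ε₀) := hρ
    push Not at hρ'
    refine ⟨not_sourceOccupied_of_lt_finishTime hρ'.1, ?_⟩
    have hpos : 0 < nu (width (k m) (N m)) (j m + 1) (t m) := by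
      have := hm (j m) le_rfl
      rw [mu_eq_nu] at this
      exact lt_of_lt_of_le (by positivity) this
    have h2 := (min_le_left ε₀ 1).trans_lt hρ'.2
    rw [occupancy_eq_pop, mu_eq_nu, div_sub_one hpos.ne', abs_div, abs_of_pos hpos,
      lt_div_iff₀ hpos] at h2
    exact h2
  have h1 : 1 ≤ (law (k m) (N m)).real good + (law (k m) (N m)).real bad := by
    have h3 : (Set.univ : Set (ℕ → Walk (k m) (N m))) ⊆ good ∪ bad := fun ρ _ => by
      by_cases hg : ρ ∈ good
      · exact Or.inl hg
      · exact Or.inr (hsub hg)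
    have h4 := measureReal_mono (μ := law (k m) (N m)) h3
    rw [probReal_univ] at h4
    exact h4.trans (measureReal_union_le _ _)
  rw [← ENNReal.toReal_lt_toReal (ha.trans_le le_top).ne (measure_ne_top _ _)]
  change a.toReal < (law (k m) (N m)).real good
  linarith

/-! ### The equal layers model. -/

section Equal

lemma width_equalLayers {w : ℕ+} {b : ℕ} (h1 : 1 ≤ b) (h2 : b ≤ k) :
    width k (equalLayers w) b = (w : ℕ) := by
  rw [width, size, if_pos (by omega), equalLayers, if_neg (by omega)]

lemma weight_equalLayers {w : ℕ+} {b : ℕ} (hb : b ≤ k) :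
    weight (width k (equalLayers w)) (b + 1) = ((w : ℕ) : ℝ) ^ b := by
  induction b with
  | zero => simp [weight, width_zero]
  | succ b ih => rw [weight_succ, ih (by omega), width_equalLayers (by omega) hb, pow_succ]

/-- Here ν_g = w (t/w)^g / g! for g ≥ 1. If t/w is not tiny, the enormous w makes every ν_g with g ≤
k + 1 large, so a single bounded ν_g forces t/w to be tiny; then the numbers decrease all the way
and blocking is negligible. -/
lemma regular_equalLayers {w : ℕ+} {c : ℝ} (hk : 1 ≤ k) (hc : 0 < c) (hc1 : c ≤ 1)
    (hw : (2048 / c ^ 3) ^ (k ^ 2) ≤ ((w : ℕ) : ℝ)) :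
    Regular k (width k (equalLayers w)) c := by
  have hn : ∀ a, 0 < width k (equalLayers w) a := fun a => width_pos a
  have hk' : (1 : ℝ) ≤ k := by exact_mod_cast hk
  have hw0 : (0 : ℝ) < (w : ℕ) := by exact_mod_cast w.pos
  have hk2 : k ≤ k ^ 2 := Nat.le_self_pow (by norm_num) k
  have hone : 1 ≤ k ^ 2 := hk.trans hk2
  have hk4 : (k : ℝ) + 1 ≤ 2 ^ k := by exact_mod_cast (Nat.lt_two_pow_self : k < 2 ^ k)
  have hksq : (k : ℝ) ^ 2 ≤ 4 ^ k := by
    have : (4 : ℝ) ^ k = (2 ^ k) ^ 2 := by rw [← pow_mul, mul_comm, pow_mul]; norm_num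
    rw [this]
    gcongr
    linarith
  -- With H = k nothing lies beyond the regime, so the filling condition is an empty sum.
  refine ⟨?_, fun t ht hex => ⟨k, ?_⟩⟩
  · rw [width_equalLayers le_rfl hk]
    have h1 : (((k : ℝ) + 1) ^ 2) ^ 2 ≤ 16 ^ k := by
      have : (16 : ℝ) ^ k = ((2 ^ k) ^ 2) ^ 2 := by
        rw [← pow_mul, ← pow_mul, mul_comm, pow_mul]; norm_num
      rw [this]
      gcongr
    have h2 : (16 : ℝ) ^ k / c ^ 2 ≤ (2048 / c ^ 3) ^ (k ^ 2) := by
      have hb : 16 / c ^ 2 ≤ 2048 / c ^ 3 := by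
        rw [div_le_div_iff₀ (by positivity) (by positivity)]
        have : 0 < c ^ 2 := by positivity
        nlinarith
      have hb1 : 1 ≤ 16 / c ^ 2 := by
        rw [one_le_div (by positivity)]
        nlinarith
      calc (16 : ℝ) ^ k / c ^ 2 ≤ 16 ^ (k ^ 2) / (c ^ 2) ^ (k ^ 2) := by
            have hc2 : (c ^ 2) ^ (k ^ 2) ≤ c ^ 2 :=
              pow_le_of_le_one (by positivity) (by nlinarith) (by omega)
            gcongr
            norm_num
        _ = (16 / c ^ 2) ^ (k ^ 2) := by rw [div_pow]
        _ ≤ _ := by gcongr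
    rw [div_le_iff₀ (by positivity)] at h2
    have : 0 < c ^ 2 := by positivity
    nlinarith
  · have key : (k : ℝ) ^ 2 * 4 ^ k * (t / (w : ℕ)) ≤ c := by
      by_contra! hlt
      obtain ⟨g, hg1, hgk, hg⟩ := hex
      obtain ⟨b, rfl⟩ := Nat.exists_eq_add_of_le' hg1
      set x := c / ((k : ℝ) ^ 2 * 4 ^ k) with hx
      have hx0 : 0 < x := by positivity
      have hx1 : x ≤ 1 := by
        rw [hx, div_le_one (by positivity)]
        have h4 : (1 : ℝ) ≤ 4 ^ k := one_le_pow₀ (by norm_num)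
        have : (1 : ℝ) ≤ (k : ℝ) ^ 2 := one_le_pow₀ hk'
        nlinarith
      have hxt : x < t / (w : ℕ) := by
        rw [hx, div_lt_iff₀ (by positivity)]
        linarith
      have hnu : nu (width k (equalLayers w)) (b + 1) t =
          (w : ℕ) * (t / (w : ℕ)) ^ (b + 1) / (b + 1).factorial := by
        unfold nu
        rw [weight_equalLayers (by omega), div_pow, pow_succ ((w : ℕ) : ℝ) b]
        field_simp
      have h1 : (w : ℕ) * x ^ (k + 1) / (k + 1).factorial < 2 / c := by
        refine lt_of_lt_of_le ?_ hg
        rw [hnu]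
        refine div_lt_div₀ ?_ ?_ (by positivity) (by positivity)
        · refine mul_lt_mul_of_pos_left ?_ hw0
          exact (pow_le_pow_of_le_one hx0.le hx1 hgk).trans_lt
            (pow_lt_pow_left₀ hxt hx0.le (by omega))
        · exact_mod_cast Nat.factorial_le hgk
      have hf : ((k + 1).factorial : ℝ) ≤ ((k : ℝ) + 1) ^ (k + 1) := by
        exact_mod_cast Nat.factorial_le_pow (k + 1)
      have h2 : ((w : ℕ) : ℝ) < 2 / c * (((k : ℝ) + 1) / x) ^ (k + 1) := by
        rw [div_lt_iff₀ (by positivity)] at h1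
        rw [div_pow, ← mul_div_assoc, lt_div_iff₀ (by positivity)]
        refine h1.trans_le ?_
        gcongr
      have h3 : ((k : ℝ) + 1) / x ≤ 32 ^ k / c := by
        have : ((k : ℝ) + 1) / x = (k + 1) * k ^ 2 * 4 ^ k / c := by
          rw [hx]; field_simp
        rw [this]
        have e : (32 : ℝ) ^ k = 2 ^ k * 4 ^ k * 4 ^ k := by
          rw [← mul_pow, ← mul_pow]; norm_num
        rw [e]
        gcongr
      have hc1' : 1 ≤ 1 / c := by rwa [one_le_div hc]
      have h4 : 2 / c * (((k : ℝ) + 1) / x) ^ (k + 1) ≤ (2048 / c ^ 3) ^ (k ^ 2) := by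
        calc 2 / c * (((k : ℝ) + 1) / x) ^ (k + 1)
            ≤ 2 / c * (32 ^ k / c) ^ (k + 1) := by gcongr
          _ = 2 / c * (32 ^ (k * (k + 1)) * (1 / c) ^ (k + 1)) := by
              rw [div_pow, ← pow_mul, one_div, inv_pow, div_eq_mul_inv _ (c ^ (k + 1))]
          -- All exponents are raised to multiples of k²; the base 2048 / c³ is (2/c) · 32² ·
          -- (1/c)².
          _ ≤ (2 / c) ^ (k ^ 2) * (32 ^ (2 * k ^ 2) * (1 / c) ^ (2 * k ^ 2)) := by
              have hb : 1 ≤ 2 / c := by rw [one_le_div hc]; linarith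
              have hn1 : k * (k + 1) ≤ 2 * k ^ 2 := by nlinarith
              have hn2 : k + 1 ≤ 2 * k ^ 2 := by omega
              gcongr
              · exact le_self_pow₀ hb (by omega)
              · norm_num
          _ = (2048 / c ^ 3) ^ (k ^ 2) := by
              rw [pow_mul, pow_mul, ← mul_pow, ← mul_pow]
              congr 1
              field_simp
              norm_num
      linarith
    have h4 : (4 : ℝ) ≤ 4 ^ k := le_self_pow₀ (by norm_num) (by omega)
    have hk2' : (1 : ℝ) ≤ (k : ℝ) ^ 2 := one_le_pow₀ hk'
    have htw : 4 * t ≤ (w : ℕ) := by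
      have h5 : 0 < t / (w : ℕ) := by positivity
      have h6 : 4 * (t / (w : ℕ)) ≤ (k : ℝ) ^ 2 * 4 ^ k * (t / (w : ℕ)) := by
        gcongr
        nlinarith
      have h7 : 4 * (t / (w : ℕ)) ≤ 1 := h6.trans (key.trans hc1)
      rw [← mul_div_assoc, div_le_one hw0] at h7
      exact h7
    have hdec : Decreasing (width k (equalLayers w)) k t := by
      refine ⟨fun a h1 h2 => ?_, fun a h1 h2 => ?_⟩
      all_goals
        rw [width_equalLayers h1 (by omega)]
        have : (1 : ℝ) ≤ a := by exact_mod_cast h1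
        nlinarith
    refine ⟨hk, le_rfl, hdec, ?_, by simp; positivity⟩
    have hsum : ∑ b ∈ Finset.Icc 1 k, nu (width k (equalLayers w)) b t /
        width k (equalLayers w) b ≤ k * (t / (w : ℕ)) := by
      have : ∀ b ∈ Finset.Icc 1 k, nu (width k (equalLayers w)) b t /
          width k (equalLayers w) b ≤ t / (w : ℕ) := by
        intro b hb
        rw [Finset.mem_Icc] at hb
        rw [width_equalLayers hb.1 hb.2]
        have h8 := hdec.nu_le hn ht.le le_rfl hb.1 hb.2
        rw [nu_one width_zero] at h8
        gcongr
      refine (Finset.sum_le_card_nsmul _ _ _ this).trans ?_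
      simp
    calc (k : ℝ) * (4 ^ k * ∑ b ∈ Finset.Icc 1 k, nu (width k (equalLayers w)) b t /
        width k (equalLayers w) b) ≤ k * (4 ^ k * (k * (t / (w : ℕ)))) := by gcongr
      _ = (k : ℝ) ^ 2 * 4 ^ k * (t / (w : ℕ)) := by ring
      _ ≤ c := key

/-- The hypothesis on k says k² log log n ≤ log n, that is, n ≥ (log n)^(k²). This beats B^(k²) for
every fixed B, with a spare factor e^(k²) that absorbs the passage from n to w = n / k. -/
lemma eventually_pow_le_width {k : ℕ → ℕ} {w : ℕ → ℕ+}
    (hn : Tendsto (fun m => k m * (w m : ℕ)) atTop atTop)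
    (hk : ∀ᶠ m in atTop, 1 ≤ k m ∧ (k m : ℝ) ≤
        Real.sqrt (Real.log ((k m * (w m : ℕ) : ℕ) : ℝ) /
          Real.log (Real.log ((k m * (w m : ℕ) : ℕ) : ℝ)))) {B : ℝ} (hB : 0 < B) :
    ∀ᶠ m in atTop, B ^ (k m ^ 2) ≤ ((w m : ℕ) : ℝ) := by
  have hlog : Tendsto (fun m => Real.log ((k m * (w m : ℕ) : ℕ) : ℝ)) atTop atTop :=
    Real.tendsto_log_atTop.comp (tendsto_natCast_atTop_atTop.comp hn)
  have hloglog := Real.tendsto_log_atTop.comp hlog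
  filter_upwards [hk, hlog.eventually_ge_atTop 0,
    hloglog.eventually_ge_atTop (|Real.log B| + 1)] with m hm h1 h2
  simp only [Function.comp] at h2
  set y := Real.log ((k m * (w m : ℕ) : ℕ) : ℝ) with hy
  have hl0 : 0 < Real.log y := lt_of_lt_of_le (by positivity) h2
  have hk1 : (1 : ℝ) ≤ k m := by exact_mod_cast hm.1
  have hw0 : (0 : ℝ) < (w m : ℕ) := by exact_mod_cast (w m).pos
  have h3 : (k m : ℝ) ^ 2 ≤ y / Real.log y := by
    have := pow_le_pow_left₀ (by positivity) hm.2 2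
    rwa [Real.sq_sqrt (div_nonneg h1 hl0.le)] at this
  rw [le_div_iff₀ hl0] at h3
  have h4 : y = Real.log (k m) + Real.log ((w m : ℕ) : ℝ) := by
    rw [hy, Nat.cast_mul, Real.log_mul (by positivity) hw0.ne']
  have h5 : Real.log (k m) ≤ (k m : ℝ) ^ 2 := by
    have := Real.log_le_sub_one_of_pos (show (0 : ℝ) < k m by positivity)
    nlinarith
  have h6 : (k m : ℝ) ^ 2 * Real.log B ≤ Real.log ((w m : ℕ) : ℝ) := by
    have h7 := mul_le_mul_of_nonneg_left h2 (sq_nonneg (k m : ℝ))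
    have h8 := mul_le_mul_of_nonneg_left (le_abs_self (Real.log B)) (sq_nonneg (k m : ℝ))
    linarith
  rw [← Real.log_le_log_iff (by positivity) hw0, Real.log_pow]
  push_cast
  exact h6

end Equal

/-! ### The growing layers model. -/

section Growing

lemma width_growingLayers {d : ℕ+} {b : ℕ} (h1 : 1 ≤ b) :
    width k (growingLayers d) b = ((d : ℕ) : ℝ) ^ (k + 1 - b) := by
  rw [width, size, if_pos (by omega), growingLayers]
  push_cast
  rfl

lemma width_growingLayers_succ {d : ℕ+} {b : ℕ} (h1 : 1 ≤ b) (h2 : b ≤ k) :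
    width k (growingLayers d) b = (d : ℕ) * width k (growingLayers d) (b + 1) := by
  rw [width_growingLayers h1, width_growingLayers (by omega), ← pow_succ',
    show k + 1 - b = k + 1 - (b + 1) + 1 by omega]

lemma weight_growingLayers_le {d : ℕ+} (b : ℕ) :
    weight (width k (growingLayers d)) (b + 1) ≤ ((d : ℕ) : ℝ) ^ (k * b) := by
  have hd : (1 : ℝ) ≤ (d : ℕ) := by exact_mod_cast d.pos
  induction b with
  | zero => simp [weight, width_zero]
  | succ b ih =>
    rw [weight_succ, Nat.mul_succ, pow_add]
    have h := width_growingLayers (k := k) (d := d) (b := b + 1) (by omega)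
    have : width k (growingLayers d) (b + 1) ≤ ((d : ℕ) : ℝ) ^ k := by
      rw [h]
      exact pow_le_pow_right₀ hd (by omega)
    exact mul_le_mul ih this (width_pos _).le (by positivity)

/-- The extra last width is what lets the geometric sum close by induction. -/
lemma sum_width_growingLayers_le {d : ℕ+} (hd : 2 ≤ (d : ℕ)) {H u : ℕ} (hHu : H + 1 ≤ u)
    (hu : u ≤ k) :
    ∑ b ∈ Finset.Ioc H u, width k (growingLayers d) b + width k (growingLayers d) u ≤
      2 * width k (growingLayers d) (H + 1) := by
  have hd' : (2 : ℝ) ≤ (d : ℕ) := by exact_mod_cast hd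
  induction u, hHu using Nat.le_induction with
  | base => simp [two_mul]
  | succ u h ih =>
    have h1 := ih (by omega)
    have h2 := width_growingLayers_succ (d := d) (show 1 ≤ u by omega) (show u ≤ k by omega)
    have h3 := width_pos (k := k) (N := growingLayers d) (u + 1)
    rw [← Finset.insert_Ioc_right_eq_Ioc_add_one (by omega), Finset.sum_insert (by simp)]
    nlinarith

/-- Beyond the depth at which the expected numbers are least, they increase. -/
lemma nu_growingLayers_mono {d : ℕ+} (hd : 2 ≤ (d : ℕ)) {H : ℕ} {t : ℝ} (ht : 0 < t)
    (hH : 1 ≤ H) (hHt : (H + 1) * width k (growingLayers d) H ≤ t) {g : ℕ} (hg : H ≤ g)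
    (hgk : g ≤ k + 1) :
    nu (width k (growingLayers d)) H t ≤ nu (width k (growingLayers d)) g t := by
  have hn : ∀ a, 0 < width k (growingLayers d) a := fun a => width_pos a
  have hd' : (2 : ℝ) ≤ (d : ℕ) := by exact_mod_cast hd
  have hstep : ∀ b, H ≤ b → b ≤ k → (b + 1) * width k (growingLayers d) b ≤ t := by
    intro b hb
    induction b, hb using Nat.le_induction with
    | base => exact fun _ => hHt
    | succ b hb ih =>
      intro hbk
      have h1 := ih (by omega)
      rw [width_growingLayers_succ (show 1 ≤ b by omega) (by omega)] at h1
      have h3 := hn (b + 1)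
      have hb0 : (0 : ℝ) ≤ b := Nat.cast_nonneg b
      refine le_trans ?_ h1
      push_cast
      rw [← mul_assoc]
      gcongr
      nlinarith
  induction g, hg using Nat.le_induction with
  | base => exact le_rfl
  | succ g hg ih =>
    refine (ih (by omega)).trans ?_
    rw [nu_succ hn]
    refine le_mul_of_one_le_right (nu_nonneg hn g ht.le) ?_
    have := hn g
    rw [one_le_div (by positivity)]
    exact hstep g hg (by omega)

/-- If H² < k, then t ≥ (H + 1) n_H gives ν_H at least a power of d with exponent (k + 1 - H) H - k
(H - 1) = k + H - H² ≥ 1. So the turning depth tends to infinity with k. -/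
lemma le_sq_of_nu_growingLayers_lt {d : ℕ+} {H : ℕ} {t : ℝ} (hH : 1 ≤ H)
    (hHt : (H + 1) * width k (growingLayers d) H ≤ t)
    (hnu : nu (width k (growingLayers d)) H t < (d : ℕ)) : k ≤ H ^ 2 := by
  by_contra! hlt
  have hn : ∀ a, 0 < width k (growingLayers d) a := fun a => width_pos a
  have hd : (1 : ℝ) ≤ (d : ℕ) := by exact_mod_cast d.pos
  refine absurd hnu (not_lt.2 ?_)
  obtain ⟨b, rfl⟩ := Nat.exists_eq_add_of_le' hH
  have hw := weight_pos hn (b + 1)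
  unfold nu
  rw [le_div_iff₀ (by positivity)]
  have hf : ((b + 1).factorial : ℝ) ≤ (((b + 1 : ℕ) : ℝ) + 1) ^ (b + 1) := by
    have h1 : ((b + 1).factorial : ℝ) ≤ ((b + 1 : ℕ) : ℝ) ^ (b + 1) := by
      exact_mod_cast Nat.factorial_le_pow (b + 1)
    refine h1.trans ?_
    gcongr
    linarith
  have hexp : 1 + k * b ≤ (k + 1 - (b + 1)) * (b + 1) := by
    obtain ⟨q, hq⟩ := Nat.exists_eq_add_of_le (show b ≤ k by nlinarith)
    subst hq
    rw [show b + q + 1 - (b + 1) = q by omega]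
    nlinarith
  calc ((d : ℕ) : ℝ) * ((b + 1).factorial * weight (width k (growingLayers d)) (b + 1))
      ≤ (d : ℕ) * ((((b + 1 : ℕ) : ℝ) + 1) ^ (b + 1) * ((d : ℕ) : ℝ) ^ (k * b)) := by
        gcongr
        exact weight_growingLayers_le b
    _ = (((b + 1 : ℕ) : ℝ) + 1) ^ (b + 1) * ((d : ℕ) : ℝ) ^ (1 + k * b) := by
        rw [pow_add]; ring
    _ ≤ (((b + 1 : ℕ) : ℝ) + 1) ^ (b + 1) *
          ((d : ℕ) : ℝ) ^ ((k + 1 - (b + 1)) * (b + 1)) := by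
        gcongr
    _ = ((((b + 1 : ℕ) : ℝ) + 1) * width k (growingLayers d) (b + 1)) ^ (b + 1) := by
        rw [width_growingLayers (by omega), mul_pow, pow_mul]
    _ ≤ t ^ (b + 1) := by
        have := hn (b + 1)
        gcongr

lemma regular_growingLayers {d : ℕ+} {c : ℝ} {H₀ : ℕ} (hc : 0 < c)
    (hH₀ : 3 ≤ H₀) (hkH : H₀ ^ 2 ≤ k) (hd : 64 ≤ (d : ℕ)) (hdc : 2 / c < (d : ℕ))
    (hbig : ∀ H : ℕ, H₀ ≤ H → 64 ^ 3 * (H : ℝ) ^ 4 ≤ c * 16 ^ H)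
    (hlarge : (((k : ℝ) + 1) ^ 2) ^ 2 ≤ c ^ 2 * 16 ^ k) :
    Regular k (width k (growingLayers d)) c := by
  classical
  have hn : ∀ a, 0 < width k (growingLayers d) a := fun a => width_pos a
  have hd' : (64 : ℝ) ≤ (d : ℕ) := by exact_mod_cast hd
  have hk1 : 1 ≤ k := by nlinarith
  refine ⟨?_, fun t ht hex => ?_⟩
  · rw [width_growingLayers le_rfl, Nat.add_sub_cancel]
    refine hlarge.trans ?_
    gcongr
    linarith
  set n := width k (growingLayers d) with hn_def
  -- As ν_{b+1} / ν_b = t / ((b + 1) n_b), H is the first positive depth from which ν does not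
  -- decrease, capped at k.
  have hP : ∃ b : ℕ, 1 ≤ b ∧ (b = k ∨ (b + 1) * n b ≤ t) := ⟨k, hk1, Or.inl rfl⟩
  set H := Nat.find hP with hH_def
  have hHspec := Nat.find_spec hP
  rw [← hH_def] at hHspec
  obtain ⟨hH1, hHor⟩ := hHspec
  have hHk : H ≤ k := Nat.find_min' hP ⟨hk1, Or.inl rfl⟩
  have hlt : ∀ b, 1 ≤ b → b < H → t < (b + 1) * n b := by
    intro b h1 h2
    have := Nat.find_min hP h2
    push Not at this
    exact (this h1).2
  -- Before the last step the next inequality t < (a + 2) n_{a+1} is available as well, and n_a = d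
  -- n_{a+1} with d ≥ 64 yields the factor 8.
  have hdec : Decreasing n H t := by
    refine ⟨fun a h1 h2 => ?_, fun a h1 h2 => (hlt a h1 (by omega)).le⟩
    have h3 := hlt (a + 1) (by omega) h2
    have h4 := width_growingLayers_succ (d := d) h1 (show a ≤ k by omega)
    rw [← hn_def] at h4
    rw [h4]
    have h5 := hn (a + 1)
    push_cast at h3
    have ha : (1 : ℝ) ≤ a := by exact_mod_cast h1
    have h6 : 8 * ((a : ℝ) + 1 + 1) ≤ (a + 1) * (d : ℕ) := by nlinarith
    have h7 := mul_le_mul_of_nonneg_right h6 h5.le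
    linarith
  -- ν_H is least among the ν_g with 1 ≤ g ≤ k + 1, so one bounded ν_g bounds ν_H below d.
  have hkH2 : k ≤ H ^ 2 := by
    rcases hHor with hHk' | hHt
    · rw [hHk']; exact Nat.le_self_pow (by norm_num) k
    · obtain ⟨g, hg1, hgk, hg⟩ := hex
      refine le_sq_of_nu_growingLayers_lt hH1 hHt (lt_of_le_of_lt ?_ hdc)
      refine le_trans ?_ hg
      rcases le_total g H with hgH | hgH
      · exact hdec.nu_le hn ht.le hg1 hgH le_rfl
      · exact nu_growingLayers_mono (by omega) ht hH1 hHt hgH hgk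
  have hHH : H₀ ≤ H := by
    by_contra! h
    nlinarith
  have hH' : (3 : ℝ) ≤ H := by exact_mod_cast hH₀.trans hHH
  refine ⟨H, hH1, hHk, hdec, ?_, ?_⟩
  · have hn1 : n 1 = ((d : ℕ) : ℝ) ^ k := by
      rw [hn_def, width_growingLayers le_rfl, Nat.add_sub_cancel]
    obtain ⟨e, he⟩ := Nat.exists_eq_add_of_le' (show 3 ≤ H by omega)
    have hHpred : n (H - 1) = (d : ℕ) * n H := by
      have := width_growingLayers_succ (k := k) (d := d) (b := H - 1) (by omega) (by omega)
      rwa [show H - 1 + 1 = H by omega] at this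
    have htH : t ≤ H * n (H - 1) := by
      have := hlt (H - 1) (by omega) (by omega)
      rw [Nat.cast_sub hH1, Nat.cast_one, sub_add_cancel] at this
      exact this.le
    have h2 := nu_two (n := n) width_zero t
    -- For b < H, ν_b / n_b = ν_{b+1} (b + 1) / t and ν_{b+1} ≤ ν_2. At b = H the next step need not
    -- decrease; there 1 / n_H = d / n_{H-1} ≤ H d / t is used instead.
    have hterm : ∀ b ∈ Finset.Icc 1 H, nu n b t / n b ≤ H * (d : ℕ) * t / (2 * n 1) := by
      intro b hb
      rw [Finset.mem_Icc] at hb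
      have hnb := hn b
      have hn1' := hn 1
      rcases hb.2.lt_or_eq with hbH | hbH
      · have h3 := hdec.nu_le hn ht.le (a := 2) (b := b + 1) (by omega) (by omega) hbH
        rw [nu_succ hn, h2] at h3
        have h4 : nu n b t / n b = nu n b t * (t / ((b + 1) * n b)) * ((b + 1) / t) := by
          field_simp
        have hbH' : (b : ℝ) + 1 ≤ H := by exact_mod_cast hbH
        calc nu n b t / n b ≤ t ^ 2 / (2 * n 1) * ((b + 1) / t) := by
              rw [h4]; gcongr
          _ = (b + 1) * 1 * t / (2 * n 1) := by field_simp
          _ ≤ H * (d : ℕ) * t / (2 * n 1) := by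
              gcongr
              linarith
      · have h3 := hdec.nu_le hn ht.le (a := 2) (b := b) (by omega) (by omega) hb.2
        rw [h2] at h3
        rw [hHpred, ← hbH] at htH
        rw [← hbH]
        rw [div_le_iff₀ hnb]
        refine h3.trans ?_
        rw [div_mul_eq_mul_div]
        gcongr
        nlinarith
    have hsum : ∑ b ∈ Finset.Icc 1 H, nu n b t / n b ≤ H * (H * (d : ℕ) * t / (2 * n 1)) := by
      refine (Finset.sum_le_card_nsmul _ _ _ hterm).trans ?_
      simp
    have hratio : n (H - 1) * (d : ℕ) ^ (e + 1) = n 1 := by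
      rw [hn1, hn_def, width_growingLayers (by omega), ← pow_add]
      congr 1
      omega
    have hde : 64 ^ e ≤ ((d : ℕ) : ℝ) ^ e := by gcongr
    -- t ≤ H n_{H-1}, while n_1 is larger than n_{H-1} by d^(H-2). With e = H - 3 this gain of 64^e
    -- outweighs the 4^H of the crude moment bound.
    have h6 : (H : ℝ) * (d : ℕ) * t / (2 * n 1) ≤ H ^ 2 / 64 ^ e := by
      have hnp := hn (H - 1)
      rw [← hratio, div_le_div_iff₀ (by positivity) (by positivity)]
      calc (H : ℝ) * (d : ℕ) * t * 64 ^ e ≤ H * (d : ℕ) * (H * n (H - 1)) * (d : ℕ) ^ e := by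
            gcongr
        _ = H ^ 2 * (n (H - 1) * (d : ℕ) ^ (e + 1)) := by rw [pow_succ]; ring
        _ ≤ H ^ 2 * (2 * (n (H - 1) * (d : ℕ) ^ (e + 1))) := by
            refine mul_le_mul_of_nonneg_left ?_ (by positivity)
            have : 0 ≤ n (H - 1) * ((d : ℕ) : ℝ) ^ (e + 1) := by positivity
            linarith
    calc (H : ℝ) * (4 ^ H * ∑ b ∈ Finset.Icc 1 H, nu n b t / n b)
        ≤ H * (4 ^ H * (H * (H ^ 2 / 64 ^ e))) := by
          gcongr
          exact hsum.trans (by gcongr)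
      _ = 64 ^ 3 * (H : ℝ) ^ 4 / 16 ^ H := by
          have h7 : (64 : ℝ) ^ H = 4 ^ H * 16 ^ H := by rw [← mul_pow]; norm_num
          have h8 : (64 : ℝ) ^ H = 64 ^ e * 64 ^ 3 := by rw [he, pow_add]
          rw [h7] at h8
          have h9 : (4 : ℝ) ^ H = 64 ^ e * 64 ^ 3 / 16 ^ H := by
            rw [eq_div_iff (by positivity)]; exact h8
          rw [h9]
          field_simp
      _ ≤ c := by
          rw [div_le_iff₀ (by positivity)]
          exact hbig H hHH
  -- The widths beyond H sum to at most 2 n_{H+1} = 2 n_H / d, and (H + 1) n_H ≤ t; d > 2/c supplies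
  -- the factor c.
  · rcases hHor with hHk' | hHt
    · rw [hHk']
      simp
      positivity
    · rcases hHk.lt_or_eq with hHlt | hHeq
      · have h1 := sum_width_growingLayers_le (k := k) (d := d) (by omega) hHlt le_rfl
        have h2 := width_growingLayers_succ (d := d) hH1 hHk
        rw [← hn_def] at h1 h2
        have h3 := hn k
        have h4 := hn (H + 1)
        rw [h2] at hHt
        have h5 : 2 < c * (d : ℕ) := by rwa [div_lt_iff₀' hc] at hdc
        have hH0 : (0 : ℝ) ≤ H := by positivity
        calc (H : ℝ) * ∑ b ∈ Finset.Ioc H k, n b ≤ H * (2 * n (H + 1)) := by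
              gcongr; linarith
          _ ≤ (H + 1) * ((c * (d : ℕ)) * n (H + 1)) := by
              gcongr
              linarith
          _ = c * ((H + 1) * ((d : ℕ) * n (H + 1))) := by ring
          _ ≤ c * t := by gcongr
      · rw [hHeq]
        simp
        positivity

lemma eventually_mul_pow_le {C c : ℝ} (hc : 0 < c) :
    ∀ᶠ H : ℕ in atTop, C * (H : ℝ) ^ 4 ≤ c * 16 ^ H := by
  have h := (tendsto_pow_const_div_const_pow_of_one_lt 4 (show (1 : ℝ) < 16 by norm_num)).const_mul C
  rw [mul_zero] at h
  filter_upwards [h.eventually_le_const hc] with H hH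
  rw [← mul_div_assoc, div_le_iff₀ (by positivity)] at hH
  exact hH

end Growing

end LayersDLA

theorem proposition1 :
    -- the equal layers model: `k` layers of `w` vertices each, `n = k * w → ∞`
    (∀ (k : ℕ → ℕ) (w : ℕ → ℕ+),
      Tendsto (fun m => k m * (w m : ℕ)) atTop atTop →
      (∀ᶠ m in atTop, 1 ≤ k m ∧ (k m : ℝ) ≤
        Real.sqrt (Real.log ((k m * (w m : ℕ) : ℕ) : ℝ) /
          Real.log (Real.log ((k m * (w m : ℕ) : ℕ) : ℝ)))) →
      LayersDLA.OccupancyAsymptotics k (fun m => LayersDLA.equalLayers (w m))) ∧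
    -- the growing layers model: level `i` has `d ^ i` vertices, `d → ∞` and `k → ∞`
    (∀ (k : ℕ → ℕ) (d : ℕ → ℕ+),
      Tendsto (fun m => (d m : ℕ)) atTop atTop →
      Tendsto k atTop atTop →
      LayersDLA.OccupancyAsymptotics k (fun m => LayersDLA.growingLayers (d m))) := by
  refine ⟨fun k w hn hk => LayersDLA.occupancyAsymptotics_of_regular fun c hc hc1 => ?_,
    fun k d hd hk => LayersDLA.occupancyAsymptotics_of_regular fun c hc hc1 => ?_⟩
  · filter_upwards [hk, LayersDLA.eventually_pow_le_width hn hk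
      (show 0 < 2048 / c ^ 3 by positivity)] with m h1 h2
    exact LayersDLA.regular_equalLayers h1.1 hc hc1 h2
  · obtain ⟨H₁, hH₁⟩ := eventually_atTop.1
      (LayersDLA.eventually_mul_pow_le (C := 64 ^ 3) hc)
    obtain ⟨H₂, hH₂⟩ := eventually_atTop.1
      (LayersDLA.eventually_mul_pow_le (C := 16) (show 0 < c ^ 2 by positivity))
    filter_upwards [hk.eventually_ge_atTop ((max H₁ 3) ^ 2), hk.eventually_ge_atTop H₂,
      hk.eventually_ge_atTop 1, hd.eventually_ge_atTop 64,
      hd.eventually_ge_atTop (⌊2 / c⌋₊ + 1)] with m h1 h2 h3 h4 h5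
    refine LayersDLA.regular_growingLayers hc (le_max_right _ _) h1 h4
      ((Nat.lt_floor_add_one _).trans_le (by exact_mod_cast h5))
      (fun H hH => hH₁ H ((le_max_left _ _).trans hH)) (le_trans ?_ (hH₂ (k m) h2))
    have : (1 : ℝ) ≤ k m := by exact_mod_cast h3
    calc (((k m : ℝ) + 1) ^ 2) ^ 2 ≤ ((2 * (k m : ℝ)) ^ 2) ^ 2 := by gcongr; linarith
      _ = 16 * (k m : ℝ) ^ 4 := by ring
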